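/- **Setting.** For a graph $G$ on $\{1,\dots,N\}$, the theta SDP is the maximization of $\sum_i X_{ii}$ over real positive semidefinite $(1+N)\times(1+N)$ matrices $X$ (indices $0,\dots,N$) with $X_{00}=1$, $X_{ii}=X_{0i}$ for all $i\ge 1$, and $X_{ij}=0$ for $i\sim j$. With $E_{ij}=\frac12(e_ie_j^T+e_je_i^T)$, its dual is the minimization of $t$ over all $t,\lambda_i,\mu_{ij}\in\mathbb R$ with $Z=tE_{00}+\sum_i(\lambda_i-1)E_{ii}-\sum_i\lambda_iE_{0i}+\sum_{i\sim j}\mu_{ij}E_{ij}\succeq 0$. A dual optimal $Z$ is nondegenerate if $M=0$ is the only real symmetric matrix with $MZ=0$, $M_{00}=0$, $M_{0i}=M_{ii}$ for all $i\ge1$, and $M_{ij}=0$ for $i\sim j$. A *CHSH realization* consists of complex Hilbert spaces $H_A',H_B'$, a unit vector $|\psi'\rangle\in H_A'\otimes H_B'$ (Hilbert space tensor product) and orthogonal projections of arbitrary rank $P_{a|x}$ on $H_A'$ and $Q_{b|y}$ on $H_B'$ ($a,b,x,y\in\{0,1\}$) with $P_{0|x}+P_{1|x}=I$ and $Q_{0|y}+Q_{1|y}=I$.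 It gives $p(a,b|x,y)=\langle\psi'|P_{a|x}\otimes Q_{b|y}|\psi'\rangle$. Let $e_1,\dots,e_8$ be the events $(a,b|x,y)$ $$(0,1|1,1),\ (0,0|0,1),\ (1,1|0,0),\ (0,0|1,0),\ (1,0|1,1),\ (1,1|0,1),\ (0,0|0,0),\ (1,1|1,0),$$ and $S_{\mathrm{CHSH}}=\sum_{i=1}^8p(e_i)$. Two events are exclusive if some party uses the same setting in both with different outcomes. Let $Ci_8(1,4)$ be the circulant graph on $\{1,\dots,8\}$ with $i\sim j$ iff $i-j\equiv\pm1$ or $4\pmod 8$. Put $h=2-\sqrt2$, $k=3-2\sqrt2$, $\chi=\frac{2+\sqrt2}8$, $\xi=\frac{1+\sqrt2}8$, and let $\operatorname{circ}(r)$ be the $8\times8$ circulant matrix with first row $r$. With $\mathbf 1$ the all-ones column vector, let $$Z_{\mathrm{CHSH}}=\begin{pmatrix}2+\sqrt2&-\mathbf 1^T\\-\mathbf 1&\operatorname{circ}(1,h,0,0,k,0,0,h)\end{pmatrix},\qquad P_{\mathrm{CHSH}}=\begin{pmatrix}1&\chi\mathbf 1^T\\\chi\mathbf 1&\operatorname{circ}(\chi,0,\frac\chi2,\xi,0,\xi,\frac\chi2,0)\end{pmatrix}.$$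 The *reference realization* on $\mathbb C^2\otimes\mathbb C^2$ has state $|\psi\rangle=\frac1{\sqrt2}(1,0,0,1)^T$ and projections $|A_{x,a}\rangle\langle A_{x,a}|$, $|B_{y,b}\rangle\langle B_{y,b}|$, where, with $\alpha=\frac1{\sqrt2}$, $c=\cos\frac\pi8$, $d=\sin\frac\pi8$, $$A_{0,0}=(1,0),\ A_{0,1}=(0,-1),\ A_{1,0}=(\alpha,\alpha),\ A_{1,1}=(\alpha,-\alpha),$$ $$B_{0,0}=(c,d),\ B_{0,1}=(d,-c),\ B_{1,0}=(c,-d),\ B_{1,1}=(-d,-c).$$ For $e_i=(a,b|x,y)$ put $|v_i\rangle=|A_{x,a}\rangle\otimes|B_{y,b}\rangle$ if $i\ge2$, and $|v_1\rangle=-|A_{1,0}\rangle\otimes|B_{1,1}\rangle$. **Theorem.** 1. The exclusivity graph of $e_1,\dots,e_8$ is $Ci_8(1,4)$. The theta SDP of $Ci_8(1,4)$ has value $2+\sqrt2$, attained, and $P_{\mathrm{CHSH}}$ is its unique optimal solution. $Z_{\mathrm{CHSH}}$ is dual optimal with dual value $2+\sqrt2$, and it is nondegenerate. 2. The reference realization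 is a CHSH realization with $S_{\mathrm{CHSH}}=2+\sqrt2$, and $P_{\mathrm{CHSH}}$ is the Gram matrix of $|\psi\rangle,\Pi_1|\psi\rangle,\dots,\Pi_8|\psi\rangle$, where $\Pi_i=|A_{x,a}\rangle\langle A_{x,a}|\otimes|B_{y,b}\rangle\langle B_{y,b}|$ for $e_i=(a,b|x,y)$. 3. Every CHSH realization satisfies $S_{\mathrm{CHSH}}\le2+\sqrt2$. If equality holds, there are Hilbert spaces $K_A,K_B$, isometries $V_A:\mathbb C^2\otimes K_A\to H_A'$ and $V_B:\mathbb C^2\otimes K_B\to H_B'$, and a unit vector $|junk\rangle\in K_A\otimes K_B$ such that (with tensor factors regrouped by party) $$(V_A\otimes V_B)(|\psi\rangle\otimes|junk\rangle)=|\psi'\rangle,$$ $$(V_A\otimes V_B)\big((|A_{x,a}\rangle\langle A_{x,a}|\otimes|B_{y,b}\rangle\langle B_{y,b}|)|\psi\rangle\otimes|junk\rangle\big)=(P_{a|x}\otimes Q_{b|y})|\psi'\rangle\quad\text{for all }a,b,x,y,$$ $$(V_A\otimes V_B)(|v_i\rangle\otimes|junk\rangle)=\chi^{-1/2}\,\Pi_i'|\psi'\rangle\quad(i=1,\dots,8),\qquad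 \Pi_i'=P_{a|x}\otimes Q_{b|y}\text{ for }e_i=(a,b|x,y).$$ -/

import Mathlib

open scoped TensorProduct InnerProductSpace

universe u v

noncomputable section

namespace CHSH

/-! ### The weighted theta semidefinite program of a graph, and its dual

Matrices of size `1 + N` are indexed by `Fin (N + 1)`: the index `0` is the extra row and column,
and the vertex `i : Fin N` sits at the index `i.succ`. -/

section ThetaSDP

variable {N : ℕ}

/-- `E_{ij} = (e_i e_jᵀ + e_j e_iᵀ) / 2`. -/
def symUnit (i j : Fin (N + 1)) : Matrix (Fin (N + 1)) (Fin (N + 1)) ℝ :=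
  (1 / 2 : ℝ) • (Matrix.single i j 1 + Matrix.single j i 1)

/-- Primal feasibility: `X ⪰ 0`, `X₀₀ = 1`, `Xᵢᵢ = X₀ᵢ`, and `Xᵢⱼ = 0` for `i ∼ j`. -/
def ThetaFeasible (G : SimpleGraph (Fin N)) (X : Matrix (Fin (N + 1)) (Fin (N + 1)) ℝ) : Prop :=
  X.PosSemidef ∧ X 0 0 = 1 ∧ (∀ i : Fin N, X i.succ i.succ = X 0 i.succ) ∧
    ∀ i j : Fin N, G.Adj i j → X i.succ j.succ = 0

/-- The primal objective `∑ᵢ wᵢ Xᵢᵢ`. -/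
def thetaObjective (w : Fin N → ℝ) (X : Matrix (Fin (N + 1)) (Fin (N + 1)) ℝ) : ℝ :=
  ∑ i : Fin N, w i * X i.succ i.succ

/-- The set of objective values of primal feasible matrices; the theta number is its maximum. -/
def thetaValues (G : SimpleGraph (Fin N)) (w : Fin N → ℝ) : Set ℝ :=
  {r | ∃ X, ThetaFeasible G X ∧ thetaObjective w X = r}

/-- `X` is a primal optimal solution. -/
def IsThetaOptimal (G : SimpleGraph (Fin N)) (w : Fin N → ℝ)
    (X : Matrix (Fin (N + 1)) (Fin (N + 1)) ℝ) : Prop :=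
  ThetaFeasible G X ∧ ∀ Y, ThetaFeasible G Y → thetaObjective w Y ≤ thetaObjective w X

open scoped Classical in
/-- `Z` is dual feasible with dual objective value `t`:
`Z = t E₀₀ + ∑ᵢ (lᵢ - wᵢ) Eᵢᵢ - ∑ᵢ lᵢ E₀ᵢ + ∑_{i ∼ j} mᵢⱼ Eᵢⱼ ⪰ 0`. -/
def DualFeasible (G : SimpleGraph (Fin N)) (w : Fin N → ℝ) (t : ℝ)
    (Z : Matrix (Fin (N + 1)) (Fin (N + 1)) ℝ) : Prop :=
  Z.PosSemidef ∧ ∃ (l : Fin N → ℝ) (m : Fin N → Fin N → ℝ),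
    Z = t • symUnit 0 0 + ∑ i : Fin N, (l i - w i) • symUnit i.succ i.succ
      - ∑ i : Fin N, l i • symUnit 0 i.succ
      + ∑ i : Fin N, ∑ j : Fin N, if G.Adj i j then m i j • symUnit i.succ j.succ else 0

/-- `Z` is a dual optimal solution, with dual objective value `t`. -/
def IsDualOptimal (G : SimpleGraph (Fin N)) (w : Fin N → ℝ) (t : ℝ)
    (Z : Matrix (Fin (N + 1)) (Fin (N + 1)) ℝ) : Prop :=
  DualFeasible G w t Z ∧ ∀ s Y, DualFeasible G w s Y → t ≤ s

/-- Dual nondegeneracy: `M = 0` is the only symmetric matrix with `M Z = 0` and `tr (M Aᵢ) = 0`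
for all constraint matrices `Aᵢ` of the primal program, which are `E₀₀`, `Eᵢᵢ - E₀ᵢ`, and `Eᵢⱼ`
for `i ∼ j`. -/
def DualNondegenerate (G : SimpleGraph (Fin N))
    (Z : Matrix (Fin (N + 1)) (Fin (N + 1)) ℝ) : Prop :=
  ∀ M : Matrix (Fin (N + 1)) (Fin (N + 1)) ℝ, M.IsSymm → M * Z = 0 →
    (M * symUnit 0 0).trace = 0 →
    (∀ i : Fin N, (M * (symUnit i.succ i.succ - symUnit 0 i.succ)).trace = 0) →
    (∀ i j : Fin N, G.Adj i j → (M * symUnit i.succ j.succ).trace = 0) →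
    M = 0

end ThetaSDP

/-! ### Hilbert space tensor products -/

section HilbertTensor

/-- The Hilbert space tensor product: the completion of the algebraic tensor product for the inner
product `⟪a ⊗ b, c ⊗ d⟫ = ⟪a, c⟫ ⟪b, d⟫`. -/
abbrev HilbertTensor (E F : Type*) [NormedAddCommGroup E] [InnerProductSpace ℂ E]
    [NormedAddCommGroup F] [InnerProductSpace ℂ F] : Type _ :=
  UniformSpace.Completion (E ⊗[ℂ] F)

variable {E F G H : Type*} [NormedAddCommGroup E] [InnerProductSpace ℂ E]
  [NormedAddCommGroup F] [InnerProductSpace ℂ F] [NormedAddCommGroup G] [InnerProductSpace ℂ G]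
  [NormedAddCommGroup H] [InnerProductSpace ℂ H]

/-- The bounded operator `S ⊗ T` on the Hilbert space tensor product. -/
def opTensor (S : E →L[ℂ] G) (T : F →L[ℂ] H) : HilbertTensor E F →L[ℂ] HilbertTensor G H :=
  (TensorProduct.mapL S T).completion

theorem opTensor_coe (S : E →L[ℂ] G) (T : F →L[ℂ] H) (z : E ⊗[ℂ] F) :
    opTensor S T (z : HilbertTensor E F) = (TensorProduct.mapL S T z : G ⊗[ℂ] H) :=
  ContinuousLinearMap.completion_apply_coe _ _

theorem opTensor_ext {A B : HilbertTensor E F →L[ℂ] HilbertTensor G H}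
    (h : ∀ z : E ⊗[ℂ] F, A (z : HilbertTensor E F) = B (z : HilbertTensor E F)) : A = B := by
  ext x
  induction x using UniformSpace.Completion.induction_on with
  | hp => exact isClosed_eq A.continuous B.continuous
  | ih z => exact h z

theorem opTensor_add_left (S S' : E →L[ℂ] G) (T : F →L[ℂ] H) :
    opTensor (S + S') T = opTensor S T + opTensor S' T := by
  refine opTensor_ext fun z => ?_
  rw [_root_.add_apply, opTensor_coe, opTensor_coe, opTensor_coe,
    TensorProduct.mapL_add_left, _root_.add_apply, UniformSpace.Completion.coe_add]

theorem opTensor_add_right (S : E →L[ℂ] G) (T T' : F →L[ℂ] H) :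
    opTensor S (T + T') = opTensor S T + opTensor S T' := by
  refine opTensor_ext fun z => ?_
  rw [_root_.add_apply, opTensor_coe, opTensor_coe, opTensor_coe,
    TensorProduct.mapL_add_right, _root_.add_apply, UniformSpace.Completion.coe_add]

theorem opTensor_smul_left (c : ℂ) (S : E →L[ℂ] G) (T : F →L[ℂ] H) :
    opTensor (c • S) T = c • opTensor S T := by
  refine opTensor_ext fun z => ?_
  rw [_root_.smul_apply, opTensor_coe, opTensor_coe,
    TensorProduct.mapL_smul_left, _root_.smul_apply,
    UniformSpace.Completion.coe_smul]

theorem opTensor_smul_right (c : ℂ) (S : E →L[ℂ] G) (T : F →L[ℂ] H) :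
    opTensor S (c • T) = c • opTensor S T := by
  refine opTensor_ext fun z => ?_
  rw [_root_.smul_apply, opTensor_coe, opTensor_coe,
    TensorProduct.mapL_smul_right, _root_.smul_apply,
    UniformSpace.Completion.coe_smul]

variable {K L : Type*} [NormedAddCommGroup K] [InnerProductSpace ℂ K]
  [NormedAddCommGroup L] [InnerProductSpace ℂ L]

/-- For `V : E ⊗ K → G` and `W : F ⊗ L → H` (one for each party), an ancilla vector `κ` in the
Hilbert space tensor product of `K` and `L`, and `φ ∈ E ⊗ F`, the vector `(V ⊗ W) (φ ⊗ κ)`, where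
the factors of `φ ⊗ κ` are regrouped by party. It is linear in `φ`, and for `φ = e ⊗ f` it is
`(V (e ⊗ ·) ⊗ W (f ⊗ ·)) κ`. -/
def localImage (V : E ⊗[ℂ] K →ₗᵢ[ℂ] G) (W : F ⊗[ℂ] L →ₗᵢ[ℂ] H) (κ : HilbertTensor K L) :
    E ⊗[ℂ] F →ₗ[ℂ] HilbertTensor G H :=
  TensorProduct.lift <| LinearMap.mk₂ ℂ
    (fun e f => opTensor (V.toContinuousLinearMap ∘L TensorProduct.mkL ℂ E K e)
      (W.toContinuousLinearMap ∘L TensorProduct.mkL ℂ F L f) κ)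
    (fun e e' f => by
      rw [map_add, ContinuousLinearMap.comp_add, opTensor_add_left,
        _root_.add_apply])
    (fun c e f => by
      rw [map_smul, ContinuousLinearMap.comp_smul, opTensor_smul_left,
        _root_.smul_apply])
    (fun e f f' => by
      rw [map_add, ContinuousLinearMap.comp_add, opTensor_add_right,
        _root_.add_apply])
    (fun c e f => by
      rw [map_smul, ContinuousLinearMap.comp_smul, opTensor_smul_right,
        _root_.smul_apply])

/-- On product vectors, `(V ⊗ W) ((e ⊗ f) ⊗ (k ⊗ l)) = V (e ⊗ k) ⊗ W (f ⊗ l)`. -/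
theorem localImage_tmul_tmul (V : E ⊗[ℂ] K →ₗᵢ[ℂ] G) (W : F ⊗[ℂ] L →ₗᵢ[ℂ] H) (e : E) (f : F)
    (k : K) (l : L) :
    localImage V W ((k ⊗ₜ[ℂ] l : K ⊗[ℂ] L) : HilbertTensor K L) (e ⊗ₜ[ℂ] f)
      = ((V (e ⊗ₜ[ℂ] k) ⊗ₜ[ℂ] W (f ⊗ₜ[ℂ] l) : G ⊗[ℂ] H) : HilbertTensor G H) :=
  opTensor_coe _ _ _

end HilbertTensor

/-! ### Bipartite realizations of the CHSH scenario -/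

section Scenario

variable {HA HB : Type*} [NormedAddCommGroup HA] [InnerProductSpace ℂ HA] [CompleteSpace HA]
  [NormedAddCommGroup HB] [InnerProductSpace ℂ HB] [CompleteSpace HB]

/-- Two two-outcome projective measurements: `P x a` is the projector (of arbitrary rank) of the
outcome `a` of the setting `x`. -/
def IsProjectiveMeasurements (P : Fin 2 → Fin 2 → HA →L[ℂ] HA) : Prop :=
  ∀ x, (∀ a, IsStarProjection (P x a)) ∧ P x 0 + P x 1 = 1

/-- A unit vector in the tensor product together with local projective measurements. -/
def IsRealization (P : Fin 2 → Fin 2 → HA →L[ℂ] HA) (Q : Fin 2 → Fin 2 → HB →L[ℂ] HB)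
    (ψ : HilbertTensor HA HB) : Prop :=
  IsProjectiveMeasurements P ∧ IsProjectiveMeasurements Q ∧ ‖ψ‖ = 1

/-- The event `(a, b | x, y)`: outcomes `a`, `b` for the settings `x`, `y`. -/
structure Event where
  x : Fin 2
  y : Fin 2
  a : Fin 2
  b : Fin 2

/-- Two events are exclusive if one party uses the same setting in both, with different
outcomes. -/
def Event.Exclusive (e f : Event) : Prop :=
  (e.x = f.x ∧ e.a ≠ f.a) ∨ (e.y = f.y ∧ e.b ≠ f.b)

/-- The vector `(P_{a|x} ⊗ Q_{b|y}) ψ` of the event `(a, b | x, y)`. -/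
def eventVec (P : Fin 2 → Fin 2 → HA →L[ℂ] HA) (Q : Fin 2 → Fin 2 → HB →L[ℂ] HB)
    (ψ : HilbertTensor HA HB) (e : Event) : HilbertTensor HA HB :=
  opTensor (P e.x e.a) (Q e.y e.b) ψ

/-- The probability `p(a, b | x, y) = ⟨ψ| P_{a|x} ⊗ Q_{b|y} |ψ⟩`. -/
def prob (P : Fin 2 → Fin 2 → HA →L[ℂ] HA) (Q : Fin 2 → Fin 2 → HB →L[ℂ] HB)
    (ψ : HilbertTensor HA HB) (e : Event) : ℝ :=
  (⟪ψ, eventVec P Q ψ e⟫_ℂ).re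

/-- The eight events of the CHSH witness (settings `x`, `y`, then outcomes `a`, `b`). -/
def event : Fin 8 → Event :=
  ![⟨1, 1, 0, 1⟩, ⟨0, 1, 0, 0⟩, ⟨0, 0, 1, 1⟩, ⟨1, 0, 0, 0⟩,
    ⟨1, 1, 1, 0⟩, ⟨0, 1, 1, 1⟩, ⟨0, 0, 0, 0⟩, ⟨1, 0, 1, 1⟩]

/-- The CHSH witness: the sum of the probabilities of the eight events. -/
def witness (P : Fin 2 → Fin 2 → HA →L[ℂ] HA) (Q : Fin 2 → Fin 2 → HB →L[ℂ] HB)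
    (ψ : HilbertTensor HA HB) : ℝ :=
  ∑ i : Fin 8, prob P Q ψ (event i)

end Scenario

/-! ### The graph `Ci₈(1,4)` and the explicit matrices -/

/-- The circulant graph on eight vertices with jumps `1` and `4`. -/
def ci8 : SimpleGraph (Fin 8) := SimpleGraph.circulantGraph {1, 4}

/-- The dual solution, with entries `h = 2 - √2` and `k = 3 - 2√2`. -/
def matZ : Matrix (Fin 9) (Fin 9) ℝ :=
  let h : ℝ := 2 - √2
  let k : ℝ := 3 - 2 * √2
  !![2 + √2, -1, -1, -1, -1, -1, -1, -1, -1;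
     -1, 1, h, 0, 0, k, 0, 0, h;
     -1, h, 1, h, 0, 0, k, 0, 0;
     -1, 0, h, 1, h, 0, 0, k, 0;
     -1, 0, 0, h, 1, h, 0, 0, k;
     -1, k, 0, 0, h, 1, h, 0, 0;
     -1, 0, k, 0, 0, h, 1, h, 0;
     -1, 0, 0, k, 0, 0, h, 1, h;
     -1, h, 0, 0, k, 0, 0, h, 1]

/-- `χ = (2 + √2) / 8`. -/
def chi : ℝ := (2 + √2) / 8

/-- The primal solution, with entries `χ`, `g = χ / 2` and `ξ = (1 + √2) / 8`. -/
def matP : Matrix (Fin 9) (Fin 9) ℝ :=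
  let χ : ℝ := chi
  let g : ℝ := 1 / 2 * chi
  let ξ : ℝ := (1 + √2) / 8
  !![1, χ, χ, χ, χ, χ, χ, χ, χ;
     χ, χ, 0, g, ξ, 0, ξ, g, 0;
     χ, 0, χ, 0, g, ξ, 0, ξ, g;
     χ, g, 0, χ, 0, g, ξ, 0, ξ;
     χ, ξ, g, 0, χ, 0, g, ξ, 0;
     χ, 0, ξ, g, 0, χ, 0, g, ξ;
     χ, ξ, 0, ξ, g, 0, χ, 0, g;
     χ, g, ξ, 0, ξ, g, 0, χ, 0;
     χ, 0, g, ξ, 0, ξ, g, 0, χ]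

/-! ### The reference realization -/

/-- The qubit space `ℂ²`. -/
abbrev Qubit : Type := EuclideanSpace ℂ (Fin 2)

/-- The vectors `|A_{x,a}⟩`. -/
def ketA : Fin 2 → Fin 2 → Qubit :=
  ![![!₂[1, 0], !₂[0, -1]],
    ![!₂[((1 / √2 : ℝ) : ℂ), ((1 / √2 : ℝ) : ℂ)],
      !₂[((1 / √2 : ℝ) : ℂ), ((-(1 / √2) : ℝ) : ℂ)]]]

/-- The vectors `|B_{y,b}⟩`, with `c = cos (π/8)` and `d = sin (π/8)`. -/
def ketB : Fin 2 → Fin 2 → Qubit :=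
  let c : ℝ := Real.cos (Real.pi / 8)
  let d : ℝ := Real.sin (Real.pi / 8)
  ![![!₂[(c : ℂ), (d : ℂ)], !₂[(d : ℂ), ((-c : ℝ) : ℂ)]],
    ![!₂[(c : ℂ), ((-d : ℝ) : ℂ)], !₂[((-d : ℝ) : ℂ), ((-c : ℝ) : ℂ)]]]

/-- Alice's reference projectors `|A_{x,a}⟩⟨A_{x,a}|`. -/
def refA (x a : Fin 2) : Qubit →L[ℂ] Qubit := InnerProductSpace.rankOne ℂ (ketA x a) (ketA x a)

/-- Bob's reference projectors `|B_{y,b}⟩⟨B_{y,b}|`. -/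
def refB (y b : Fin 2) : Qubit →L[ℂ] Qubit := InnerProductSpace.rankOne ℂ (ketB y b) (ketB y b)

/-- The maximally entangled state `(|00⟩ + |11⟩) / √2`. -/
def refState : Qubit ⊗[ℂ] Qubit :=
  ((1 / √2 : ℝ) : ℂ) •
    ((!₂[1, 0] : Qubit) ⊗ₜ[ℂ] (!₂[1, 0] : Qubit) + (!₂[0, 1] : Qubit) ⊗ₜ[ℂ] (!₂[0, 1] : Qubit))

/-- The product vectors `|v_i⟩ = ± |A_{x,a}⟩ ⊗ |B_{y,b}⟩` of the eight events. The sign is `-`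
for the first event only; it makes `⟨ψ|v_i⟩` positive. -/
def refVec (i : Fin 8) : Qubit ⊗[ℂ] Qubit :=
  (if i = 0 then (-1 : ℂ) else 1) •
    (ketA (event i).x (event i).a ⊗ₜ[ℂ] ketB (event i).y (event i).b)

/-! ### Self-testing -/

/-- The realization `(P, Q, ψ)` is the image of the reference realization under local isometries
`V_A : ℂ² ⊗ K_A → H_A` and `V_B : ℂ² ⊗ K_B → H_B`, with an ancilla state `|junk⟩` on `K_A ⊗ K_B`:
`(V_A ⊗ V_B) (|ψ_ref⟩ ⊗ |junk⟩) = |ψ⟩`, the same for the sub-normalized vectors of all sixteen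
events `(a, b | x, y)`, and `(V_A ⊗ V_B) (|v_i⟩ ⊗ |junk⟩) = η⁻¹ Π_i |ψ⟩` with `η = √χ`
for the eight events of the witness. -/
def IsLocallyReference {HA : Type u} {HB : Type v}
    [NormedAddCommGroup HA] [InnerProductSpace ℂ HA] [CompleteSpace HA]
    [NormedAddCommGroup HB] [InnerProductSpace ℂ HB] [CompleteSpace HB]
    (P : Fin 2 → Fin 2 → HA →L[ℂ] HA) (Q : Fin 2 → Fin 2 → HB →L[ℂ] HB)
    (ψ : HilbertTensor HA HB) : Prop :=
  ∃ (KA : Type u) (_ : NormedAddCommGroup KA) (_ : InnerProductSpace ℂ KA) (_ : CompleteSpace KA)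
    (KB : Type v) (_ : NormedAddCommGroup KB) (_ : InnerProductSpace ℂ KB) (_ : CompleteSpace KB)
    (VA : Qubit ⊗[ℂ] KA →ₗᵢ[ℂ] HA) (VB : Qubit ⊗[ℂ] KB →ₗᵢ[ℂ] HB) (junk : HilbertTensor KA KB),
    ‖junk‖ = 1 ∧
    localImage VA VB junk refState = ψ ∧
    (∀ x y a b : Fin 2,
      localImage VA VB junk (TensorProduct.mapL (refA x a) (refB y b) refState)
        = opTensor (P x a) (Q y b) ψ) ∧
    ∀ i : Fin 8,
      localImage VA VB junk (refVec i) = (((√chi)⁻¹ : ℝ) : ℂ) • eventVec P Q ψ (event i)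

end CHSH

end

open scoped TensorProduct InnerProductSpace

noncomputable section

namespace CHSH


/-! For primal feasible `X` and dual feasible `Z` of value `t`, `tr (X Z)` is the gap between `t`
and the objective of `X`, and it is nonnegative (`weak_duality`). `matZ` and `matP` both have value
`2 + √2`, so both are optimal. At gap zero `X Z = 0`; the difference of two primal optima then
solves the homogeneous system in the definition of nondegeneracy, and must vanish
(`eq_of_dualNondegenerate`, `dualNondegenerate_matZ`). That `matP` is positive semidefinite comes
from its being the Gram matrix of the reference realization (`gram_ref`).

For arbitrary realizations put `A_x = P x 0 - P x 1`, `B_y = Q y 0 - Q y 1`, `Z_B = (B₀ + B₁)/√2`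
and `X_B = (B₀ - B₁)/√2`. The witness equals `2 + √2` minus `√2/4` times `‖A₀ψ - Z_Bψ‖² + ‖A₁ψ -
X_Bψ‖²` (`witness_eq`). This gives the bound, and equality forces `A₀ψ = Z_Bψ` and `A₁ψ = X_Bψ`.
Since `Z_B` and `X_B` anticommute, `A₀` and `A₁` anticommute on `ψ`.

A qubit is then extracted on each side. On the closed subspace `qubitSpace Z X`, the map `e ⊗ k ↦ e₀
k + e₁ X k` is an isometry that turns the Pauli matrices into `Z` and `X`. The vector `φ = (ψ +
A₀ψ)/2` lies in the tensor product of the two qubit spaces, and `ψ = φ + (A₁ ⊗ X_B) φ`, so `√2 φ` is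
the junk state (`exists_localImage_refState_eq`). The projectors are affine in the observables, so
the isometries carry every reference event to the given one. -/

section ThetaSDP

/-! ### Duality, complementary slackness and uniqueness for the theta SDP. -/

variable {N : ℕ}

theorem trace_mul_symUnit (X : Matrix (Fin (N + 1)) (Fin (N + 1)) ℝ) (i j : Fin (N + 1)) :
    (X * symUnit i j).trace = (X i j + X j i) / 2 := by
  simp [symUnit, Matrix.mul_add, Matrix.trace_mul_single]
  ring

/-- For dual feasible `Z` with value `t` and primal feasible `X`, `tr (X Z) = t - ∑ wᵢ Xᵢᵢ`. -/
theorem DualFeasible.trace_mul {G : SimpleGraph (Fin N)} {w : Fin N → ℝ} {t : ℝ}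
    {Z X : Matrix (Fin (N + 1)) (Fin (N + 1)) ℝ} (hZ : DualFeasible G w t Z)
    (hX : ThetaFeasible G X) : (X * Z).trace = t - thetaObjective w X := by
  classical
  obtain ⟨-, l, m, rfl⟩ := hZ
  obtain ⟨hp, h0, h1, h2⟩ := hX
  have hs : ∀ i j, X i j = X j i := fun i j => by
    have := hp.isHermitian.apply j i
    simpa using this
  have hsum : (X * ∑ i : Fin N, ∑ j : Fin N,
      if G.Adj i j then m i j • symUnit i.succ j.succ else 0).trace = 0 := by
    simp only [Matrix.mul_sum, Matrix.trace_sum]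
    refine Finset.sum_eq_zero fun i _ => Finset.sum_eq_zero fun j _ => ?_
    split_ifs with h
    · rw [Matrix.mul_smul, Matrix.trace_smul, trace_mul_symUnit, h2 i j h, h2 j i h.symm]
      simp
    · simp
  simp only [Matrix.mul_add, Matrix.mul_sub, Matrix.trace_add, Matrix.trace_sub, Matrix.mul_smul,
    Matrix.trace_smul, Matrix.mul_sum, Matrix.trace_sum, trace_mul_symUnit] at hsum ⊢
  rw [hsum, h0, thetaObjective, sub_eq_add_neg t, ← Finset.sum_neg_distrib, add_zero, add_sub_assoc,
    ← Finset.sum_sub_distrib]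
  congr 1
  · simp
  · refine Finset.sum_congr rfl fun i _ => ?_
    rw [hs i.succ 0, h1]
    simp only [smul_eq_mul]
    ring

theorem trace_mul_nonneg_of_posSemidef {n : Type*} [Fintype n] {X Z : Matrix n n ℝ}
    (hX : X.PosSemidef) (hZ : Z.PosSemidef) : 0 ≤ (X * Z).trace := by
  classical
  obtain ⟨m, v, rfl⟩ := Matrix.posSemidef_iff_eq_sum_vecMulVec.mp hZ
  rw [Matrix.mul_sum, Matrix.trace_sum]
  refine Finset.sum_nonneg fun i _ => ?_
  rw [Matrix.mul_vecMulVec, Matrix.trace_vecMulVec, dotProduct_comm]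
  simpa using hX.dotProduct_mulVec_nonneg (v i)

/-- With `Z = ∑ v vᵀ` the trace is a sum of terms `vᵀ X v ≥ 0`. If it is zero, each term is, and `vᵀ
X v = 0` forces `X v = 0` for semidefinite `X`. -/
theorem mul_eq_zero_of_trace_mul_eq_zero {n : Type*} [Fintype n] {X Z : Matrix n n ℝ}
    (hX : X.PosSemidef) (hZ : Z.PosSemidef) (h : (X * Z).trace = 0) : X * Z = 0 := by
  classical
  obtain ⟨m, v, rfl⟩ := Matrix.posSemidef_iff_eq_sum_vecMulVec.mp hZ
  have hterm : ∀ i, (X * Matrix.vecMulVec (v i) (star (v i))).trace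
      = dotProduct (star (v i)) (X.mulVec (v i)) := fun i => by
    rw [Matrix.mul_vecMulVec, Matrix.trace_vecMulVec, dotProduct_comm]
  rw [Matrix.mul_sum, Matrix.trace_sum, Finset.sum_eq_zero_iff_of_nonneg
    (fun i _ => by rw [hterm]; exact hX.dotProduct_mulVec_nonneg (v i))] at h
  rw [Matrix.mul_sum]
  refine Finset.sum_eq_zero fun i hi => ?_
  have := h i hi
  rw [hterm, hX.dotProduct_mulVec_zero_iff] at this
  rw [Matrix.mul_vecMulVec, this, Matrix.zero_vecMulVec]

theorem weak_duality {G : SimpleGraph (Fin N)} {w : Fin N → ℝ} {t : ℝ}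
    {Z X : Matrix (Fin (N + 1)) (Fin (N + 1)) ℝ} (hZ : DualFeasible G w t Z)
    (hX : ThetaFeasible G X) : thetaObjective w X ≤ t := by
  have := trace_mul_nonneg_of_posSemidef hX.1 hZ.1
  rw [hZ.trace_mul hX] at this
  linarith

/-- If a nondegenerate dual feasible matrix and a primal feasible matrix have the same value `t`,
then every primal feasible matrix of value `t` is equal to the latter. -/
theorem eq_of_dualNondegenerate {G : SimpleGraph (Fin N)} {w : Fin N → ℝ} {t : ℝ}
    {Z X Y : Matrix (Fin (N + 1)) (Fin (N + 1)) ℝ} (hZ : DualFeasible G w t Z)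
    (hn : DualNondegenerate G Z) (hX : ThetaFeasible G X) (hY : ThetaFeasible G Y)
    (hXt : thetaObjective w X = t) (hYt : thetaObjective w Y = t) : X = Y := by
  have hX0 : X * Z = 0 := mul_eq_zero_of_trace_mul_eq_zero hX.1 hZ.1 (by
    rw [hZ.trace_mul hX, hXt, sub_self])
  have hY0 : Y * Z = 0 := mul_eq_zero_of_trace_mul_eq_zero hY.1 hZ.1 (by
    rw [hZ.trace_mul hY, hYt, sub_self])
  have hXs : ∀ i j, X i j = X j i := fun i j => by simpa using hX.1.isHermitian.apply j i
  have hYs : ∀ i j, Y i j = Y j i := fun i j => by simpa using hY.1.isHermitian.apply j i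
  -- `X` and `Y` satisfy the same affine constraints and are both annihilated by `Z`, so `X - Y`
  -- satisfies the homogeneous ones.
  refine sub_eq_zero.mp (hn (X - Y) ?_ ?_ ?_ ?_ ?_)
  · ext i j
    simp [hXs j i, hYs j i]
  · rw [Matrix.sub_mul, hX0, hY0, sub_self]
  · simp [trace_mul_symUnit, hX.2.1, hY.2.1]
  · intro i
    rw [Matrix.mul_sub, Matrix.trace_sub, trace_mul_symUnit, trace_mul_symUnit]
    simp only [Matrix.sub_apply, hX.2.2.1, hY.2.2.1, hXs i.succ 0, hYs i.succ 0]
    ring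
  · intro i j h
    rw [trace_mul_symUnit]
    simp [hX.2.2.2 _ _ h, hX.2.2.2 _ _ h.symm, hY.2.2.2 _ _ h, hY.2.2.2 _ _ h.symm]

open scoped Classical in
-- The multipliers are read off the entries: the factor `1/2` in `symUnit` gives `Z 0 i = -lᵢ / 2`,
-- hence `lᵢ = -2 Z 0 i`, and `h0` is the resulting condition on the diagonal.
theorem dualFeasible_of_entries {G : SimpleGraph (Fin N)} {w : Fin N → ℝ}
    {Z : Matrix (Fin (N + 1)) (Fin (N + 1)) ℝ} (hZ : Z.PosSemidef)
    (h0 : ∀ i : Fin N, -2 * Z 0 i.succ = Z i.succ i.succ + w i)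
    (h1 : ∀ i j : Fin N, i ≠ j → ¬ G.Adj i j → Z i.succ j.succ = 0) :
    DualFeasible G w (Z 0 0) Z := by
  have hs : ∀ i j, Z i j = Z j i := fun i j => by simpa using hZ.isHermitian.apply j i
  refine ⟨hZ, fun i => -2 * Z 0 i.succ, fun i j => Z i.succ j.succ, ?_⟩
  have hlast : ∀ p q : Fin (N + 1), (∑ i : Fin N, ∑ j : Fin N,
      if G.Adj i j then Z i.succ j.succ • symUnit i.succ j.succ else 0) p q
      = ∑ i : Fin N, ∑ j : Fin N,
        if G.Adj i j then Z i.succ j.succ * symUnit i.succ j.succ p q else 0 := by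
    intro p q
    simp only [Matrix.sum_apply]
    refine Finset.sum_congr rfl fun i _ => Finset.sum_congr rfl fun j _ => ?_
    split_ifs <;> simp
  ext p q
  simp only [Matrix.add_apply, Matrix.sub_apply, Matrix.sum_apply _ _ _ (fun i => _ • symUnit _ _),
    Matrix.smul_apply, hlast]
  refine Fin.cases ?_ (fun p => ?_) p <;> refine Fin.cases ?_ (fun q => ?_) q
  · simp [symUnit, Fin.succ_ne_zero]
    ring
  · simp [symUnit, Matrix.single_apply, Fin.succ_ne_zero, (Fin.succ_ne_zero _).symm]
    ring
  · simp [symUnit, Matrix.single_apply, Fin.succ_ne_zero, (Fin.succ_ne_zero _).symm]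
    rw [hs]
    ring
  · have hu : ∀ i j : Fin N, symUnit i.succ j.succ p.succ q.succ
        = 1 / 2 * ((if i = p ∧ j = q then 1 else 0) + if j = p ∧ i = q then 1 else 0) := by
      intro i j
      simp [symUnit, Matrix.single_apply]
    -- The double sum runs over ordered pairs, so an edge `p ∼ q` is met as `(p, q)` and as `(q,
    -- p)`, each time with weight `1/2`; hence `m = Z` without a factor.
    have hA : ∀ i j : Fin N,
        (if G.Adj i j then Z i.succ j.succ * symUnit i.succ j.succ p.succ q.succ
        else 0) = (if i = p then if j = q then
          1 / 2 * (if G.Adj p q then Z p.succ q.succ else 0) else 0 else 0) +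
          (if i = q then if j = p then
          1 / 2 * (if G.Adj p q then Z p.succ q.succ else 0) else 0 else 0) := by
      intro i j
      rw [hu, ← ite_and, ← ite_and]
      by_cases c1 : i = p ∧ j = q
      · obtain ⟨rfl, rfl⟩ := c1
        by_cases c2 : j = i
        · subst c2
          simp
        · simp [c2]
          split_ifs <;> ring
      · by_cases c2 : j = p ∧ i = q
        · obtain ⟨rfl, rfl⟩ := c2
          simp only [if_neg c1, and_self, if_true, G.adj_comm j i, hs j.succ i.succ]
          split_ifs <;> ring
        · rw [if_neg c1, if_neg c2, if_neg c1, if_neg (c := i = q ∧ j = p) fun c => c2 c.symm]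
          simp
    have hD : ∀ i : Fin N, symUnit i.succ i.succ p.succ q.succ
        = if i = p then if p = q then 1 else 0 else 0 := by
      intro i
      rw [hu]
      by_cases e1 : i = p <;> by_cases e2 : i = q <;> simp_all
      ring
    have hO : ∀ i : Fin N, symUnit 0 i.succ p.succ q.succ = 0 := by
      intro i
      simp [symUnit, (Fin.succ_ne_zero _).symm]
    have hO' : symUnit 0 0 p.succ q.succ = 0 := by
      simp [symUnit, (Fin.succ_ne_zero _).symm]
    simp only [hA, Finset.sum_add_distrib, hD, hO, hO', Finset.sum_ite_eq', Finset.mem_univ,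
        if_true,
      smul_eq_mul, mul_zero, Finset.sum_const_zero, mul_ite, Finset.sum_ite_irrel]
    by_cases e : p = q
    · subst e
      simp
      linarith [h0 p]
    · by_cases ha : G.Adj p q
      · simp [e, ha]
        ring
      · simp [e, ha, h1 p q e ha]

end ThetaSDP


/-! ### The graph, and the dual certificate `matZ`. -/

theorem ci8_adj_iff (i j : Fin 8) :
    ci8.Adj i j ↔ (j = i + 1 ∨ j = i + 4 ∨ j = i + 7) := by
  simp only [ci8, SimpleGraph.circulantGraph_adj, Set.mem_insert_iff, Set.mem_singleton_iff]
  revert i j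
  decide

theorem ci8_adj_iff_exclusive (i j : Fin 8) :
    ci8.Adj i j ↔ (event i).Exclusive (event j) := by
  simp only [ci8, SimpleGraph.circulantGraph_adj, Set.mem_insert_iff, Set.mem_singleton_iff,
    Event.Exclusive]
  revert i j
  decide

/-- An eigenbasis of the range of `matZ`. -/
def vecZ : Fin 5 → Fin 9 → ℝ :=
  ![![-(2 + √2), 1, 1, 1, 1, 1, 1, 1, 1],
    ![0, 1, √2 / 2, 0, -(√2 / 2), -1, -(√2 / 2), 0, √2 / 2],
    ![0, 0, √2 / 2, 1, √2 / 2, 0, -(√2 / 2), -1, -(√2 / 2)],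
    ![0, 1, 0, -1, 0, 1, 0, -1, 0],
    ![0, 0, 1, 0, -1, 0, 1, 0, -1]]

/-- Each coefficient is an eigenvalue of `matZ` divided by the squared length of the vector in
`vecZ`. Apart from the first vector these are the Fourier modes of frequency `1` (two) and `2`
(two); frequencies `3` and `4` lie in the kernel. -/
def coeffZ : Fin 5 → ℝ := ![(2 - √2) / 2, √2 - 1, √2 - 1, (2 - √2) / 2, (2 - √2) / 2]

theorem sq_sqrt_two : (√2 : ℝ) ^ 2 = 2 := Real.sq_sqrt (by norm_num)

theorem matZ_eq_sum : matZ = ∑ r, coeffZ r • Matrix.vecMulVec (vecZ r) (vecZ r) := by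
  have h2 := sq_sqrt_two
  ext i j
  simp only [Matrix.sum_apply, Matrix.smul_apply, Matrix.vecMulVec_apply, Fin.sum_univ_five, coeffZ,
    vecZ, smul_eq_mul, matZ]
  fin_cases i <;> fin_cases j <;> simp <;> first | done | grind

theorem posSemidef_matZ : matZ.PosSemidef := by
  rw [matZ_eq_sum]
  have h2 := sq_sqrt_two
  have h3 : (1 : ℝ) ≤ √2 := by rw [Real.one_le_sqrt]; norm_num
  refine Matrix.posSemidef_sum _ fun r _ => Matrix.PosSemidef.smul ?_ ?_
  · simpa using Matrix.posSemidef_vecMulVec_self_star (vecZ r)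
  · fin_cases r <;> simp [coeffZ] <;> nlinarith

theorem matZ_succ_eq_zero (i j : Fin 8) (hij : i ≠ j) (h : ¬ ci8.Adj i j) :
    matZ i.succ j.succ = 0 := by
  rw [ci8_adj_iff] at h
  fin_cases i <;> fin_cases j <;> simp [matZ] at hij h ⊢

theorem dualFeasible_matZ : DualFeasible ci8 (fun _ => 1) (2 + √2) matZ := by
  refine dualFeasible_of_entries posSemidef_matZ ?_ matZ_succ_eq_zero
  intro i
  fin_cases i <;> simp [matZ] <;> norm_num

theorem matZ_succ_zero (j : Fin 8) : matZ j.succ 0 = -1 := by fin_cases j <;> rfl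

/-- A column of the product of a matrix with `matZ`. -/
theorem mul_matZ_succ (M : Matrix (Fin 9) (Fin 9) ℝ) (p : Fin 9) (j : Fin 8) :
    (M * matZ) p j.succ = -M p 0 + M p j.succ
      + (2 - √2) * (M p (j + 1).succ + M p (j + 7).succ)
      + (3 - 2 * √2) * M p (j + 4).succ := by
  rw [Matrix.mul_apply]
  simp only [Fin.sum_univ_succ, Fin.sum_univ_zero, matZ]
  fin_cases j <;> simp <;> ring

/-- The zero pattern and `M Z = 0` determine each lower row of `M` from its diagonal entry. Symmetry
of `M` then makes all these diagonal entries equal, and row `0` makes their common value zero. -/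
theorem dualNondegenerate_matZ : DualNondegenerate ci8 matZ := by
  intro M hs hMZ h0 h1 h2
  have hs : ∀ i j, M i j = M j i := fun i j => hs.apply j i
  have hr := sq_sqrt_two
  have hr1 : (1 : ℝ) < √2 := by rw [Real.lt_sqrt] <;> norm_num
  have h00 : M 0 0 = 0 := by
    rw [trace_mul_symUnit] at h0
    linarith
  have hd : ∀ i : Fin 8, M i.succ 0 = M i.succ i.succ := by
    intro i
    have := h1 i
    rw [Matrix.mul_sub, Matrix.trace_sub, trace_mul_symUnit, trace_mul_symUnit] at this
    linarith [hs 0 i.succ]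
  have hadj : ∀ i j : Fin 8, ci8.Adj i j → M i.succ j.succ = 0 := by
    intro i j h
    have := h2 i j h
    rw [trace_mul_symUnit] at this
    linarith [hs i.succ j.succ]
  have a1 : ∀ i : Fin 8, M i.succ (i + 1).succ = 0 := fun i =>
    hadj _ _ ((ci8_adj_iff _ _).2 (.inl rfl))
  have a4 : ∀ i : Fin 8, M i.succ (i + 4).succ = 0 := fun i =>
    hadj _ _ ((ci8_adj_iff _ _).2 (.inr (.inl rfl)))
  have a7 : ∀ i : Fin 8, M i.succ (i + 7).succ = 0 := fun i =>
    hadj _ _ ((ci8_adj_iff _ _).2 (.inr (.inr rfl)))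
  have key : ∀ (i j : Fin 8), -M i.succ i.succ + M i.succ j.succ
      + (2 - √2) * (M i.succ (j + 1).succ + M i.succ (j + 7).succ)
      + (3 - 2 * √2) * M i.succ (j + 4).succ = 0 := by
    intro i j
    rw [← hd, ← mul_matZ_succ, hMZ]
    rfl
  -- The zeros at `i ± 1` and `i + 4` leave four unknown entries in row `i`; columns `i + 1`, `i +
  -- 3`, `i + 5`, `i + 7` of `M Z = 0` are four linear equations for them. The solution has the
  -- ratios `1/2` and `√2/2` of the entries of `matP`.
  have row : ∀ i : Fin 8, M i.succ (i + 2).succ = 1 / 2 * M i.succ i.succ ∧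
      M i.succ (i + 6).succ = 1 / 2 * M i.succ i.succ ∧
      M i.succ (i + 3).succ = √2 / 2 * M i.succ i.succ ∧
      M i.succ (i + 5).succ = √2 / 2 * M i.succ i.succ := by
    intro i
    have k3 := key i (i + 3)
    have k5 := key i (i + 5)
    have k1 := key i (i + 1)
    have k7 := key i (i + 7)
    simp only [add_assoc, Fin.reduceAdd, a1, a4, a7, add_zero] at k1 k3 k5 k7
    generalize M i.succ i.succ = m, M i.succ (i + 2).succ = a, M i.succ (i + 3).succ = b,
      M i.succ (i + 5).succ = b', M i.succ (i + 6).succ = a' at k1 k3 k5 k7 ⊢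
    clear key hd a1 a4 a7 hadj h1 h2 hs
    refine ⟨?_, ?_, ?_, ?_⟩ <;> grind
  -- The entry at `(i, i + 2)` is half of the diagonal entry of either row, because `i = (i + 2) +
  -- 6` modulo `8`. The same comparison at `(i, i + 3)` gives `e3`.
  have e2 : ∀ i : Fin 8, M (i + 2).succ (i + 2).succ = M i.succ i.succ := by
    intro i
    have := (row (i + 2)).2.1
    simp only [add_assoc, Fin.reduceAdd, add_zero] at this
    rw [hs, (row i).1] at this
    linarith
  have e3 : ∀ i : Fin 8, M (i + 3).succ (i + 3).succ = M i.succ i.succ := by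
    intro i
    have := (row (i + 3)).2.2.2
    simp only [add_assoc, Fin.reduceAdd, add_zero] at this
    rw [hs, (row i).2.2.1] at this
    exact (mul_left_cancel₀ (by positivity) this).symm
  have e1 : ∀ i : Fin 8, M (i + 1).succ (i + 1).succ = M i.succ i.succ := by
    intro i
    rw [← e2 (i + 1), add_assoc, show (1 + 2 : Fin 8) = 3 from rfl, e3]
  have ediag : ∀ i : Fin 8, M i.succ i.succ = M 1 1 := by
    intro i
    induction i using Fin.induction with
    | zero => rfl
    | succ i ih =>
      rw [← ih, ← e1 i.castSucc, Fin.coeSucc_eq_succ]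
  -- The `(0, 0)` entry of `M Z` is `-8 M 1 1`, as `M 0 0 = 0` and every other entry of row `0`
  -- equals `M 1 1`.
  have hz : M 1 1 = 0 := by
    have := congrFun (congrFun hMZ 0) 0
    rw [Matrix.mul_apply, Fin.sum_univ_succ, h00] at this
    simp only [matZ_succ_zero, hs 0 (Fin.succ _), hd, ediag, zero_mul, zero_add,
      Finset.sum_const, Finset.card_univ, Fintype.card_fin, Matrix.zero_apply] at this
    simpa using this
  have hi : ∀ i : Fin 8, M i.succ i.succ = 0 := fun i => (ediag i).trans hz
  have hall : ∀ i d : Fin 8, M i.succ (i + d).succ = 0 := by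
    intro i d
    obtain ⟨r2, r6, r3, r5⟩ := row i
    rw [hi, mul_zero] at r2 r6 r3 r5
    fin_cases d
    · simpa using hi i
    · exact a1 i
    · exact r2
    · exact r3
    · exact a4 i
    · exact r5
    · exact r6
    · exact a7 i
  ext p q
  refine Fin.cases ?_ (fun p => ?_) p <;> refine Fin.cases ?_ (fun q => ?_) q
  · exact h00
  · rw [hs, hd, hi]
    rfl
  · rw [hd, hi]
    rfl
  · rw [← add_sub_cancel p q]
    exact hall p (q - p)


/-! ### The reference realization: Pauli form of the projectors, and its Gram matrix. -/

theorem cos_pi_div_eight_sq : Real.cos (Real.pi / 8) ^ 2 = (2 + √2) / 4 := by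
  rw [Real.cos_sq, show 2 * (Real.pi / 8) = Real.pi / 4 by ring, Real.cos_pi_div_four]
  ring

/-- Eliminating the sine leaves polynomial identities in `√2` and `c = cos (π/8)`, where `√2² = 2`
and `c² = (2 + √2)/4`. -/
theorem sin_pi_div_eight_eq : Real.sin (Real.pi / 8) = (√2 - 1) * Real.cos (Real.pi / 8) := by
  have hc : 0 < Real.cos (Real.pi / 8) := Real.cos_pos_of_mem_Ioo
    ⟨by linarith [Real.pi_pos], by linarith [Real.pi_pos]⟩
  have h := Real.sin_two_mul (Real.pi / 8)
  rw [show 2 * (Real.pi / 8) = Real.pi / 4 by ring, Real.sin_pi_div_four] at h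
  have h1 := cos_pi_div_eight_sq
  have h2 := sq_sqrt_two
  refine mul_right_cancel₀ hc.ne' ?_
  linear_combination (-1 / 2 : ℝ) * h - (√2 - 1) * h1 - (1 / 4 : ℝ) * h2

theorem sqrt_chi : √chi = Real.cos (Real.pi / 8) / √2 := by
  have hc : 0 < Real.cos (Real.pi / 8) := Real.cos_pos_of_mem_Ioo
    ⟨by linarith [Real.pi_pos], by linarith [Real.pi_pos]⟩
  rw [Real.sqrt_eq_iff_mul_self_eq_of_pos (by positivity), ← sq, div_pow, cos_pi_div_eight_sq,
      sq_sqrt_two, chi]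
  ring

theorem one_div_sqrt_two : 1 / √2 = √2 / 2 := by
  rw [div_eq_div_iff (by positivity) (by norm_num)]
  linear_combination -sq_sqrt_two

theorem ofReal_sqrt_two_sq : ((√2 : ℝ) : ℂ) ^ 2 = 2 := by
  rw [← Complex.ofReal_pow, sq_sqrt_two]
  norm_num

def pauliZ (e : Qubit) : Qubit := !₂[e 0, -e 1]

def pauliX (e : Qubit) : Qubit := !₂[e 1, e 0]

theorem refA_zero (a : Fin 2) (e : Qubit) :
    refA 0 a e = (1 / 2 : ℂ) • (e + (-1 : ℂ) ^ (a : ℕ) • pauliZ e) := by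
  ext i
  fin_cases a <;> fin_cases i <;> simp [refA, ketA, pauliZ, PiLp.inner_apply, Fin.sum_univ_two,
      -inner_self_eq_norm_sq_to_K] <;>
    ring

theorem refA_one (a : Fin 2) (e : Qubit) :
    refA 1 a e = (1 / 2 : ℂ) • (e + (-1 : ℂ) ^ (a : ℕ) • pauliX e) := by
  have h2 := ofReal_sqrt_two_sq
  ext i
  simp only [refA, ketA, one_div_sqrt_two]
  fin_cases a <;> fin_cases i <;> simp [pauliX, PiLp.inner_apply, Fin.sum_univ_two, map_ofNat,
      -inner_self_eq_norm_sq_to_K] <;>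
    grind

theorem refB_zero (b : Fin 2) (e : Qubit) :
    refB 0 b e = (1 / 2 : ℂ) • (e + (-1 : ℂ) ^ (b : ℕ) •
      ((1 / √2 : ℝ) : ℂ) • (pauliZ e + pauliX e)) := by
  have h2 := ofReal_sqrt_two_sq
  have h1 : ((Real.cos (Real.pi / 8) : ℝ) : ℂ) ^ 2 = (2 + (√2 : ℝ)) / 4 := by
    rw [← Complex.ofReal_pow, cos_pi_div_eight_sq]
    norm_num
  ext i
  simp only [refB, ketB, one_div_sqrt_two, sin_pi_div_eight_eq]
  generalize Real.cos (Real.pi / 8) = c at h1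
  fin_cases b <;> fin_cases i <;> simp [pauliX, pauliZ, PiLp.inner_apply, Fin.sum_univ_two,
      -inner_self_eq_norm_sq_to_K] <;> grind

theorem refB_one (b : Fin 2) (e : Qubit) :
    refB 1 b e = (1 / 2 : ℂ) • (e + (-1 : ℂ) ^ (b : ℕ) •
      ((1 / √2 : ℝ) : ℂ) • (pauliZ e - pauliX e)) := by
  have h2 := ofReal_sqrt_two_sq
  have h1 : ((Real.cos (Real.pi / 8) : ℝ) : ℂ) ^ 2 = (2 + (√2 : ℝ)) / 4 := by
    rw [← Complex.ofReal_pow, cos_pi_div_eight_sq]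
    norm_num
  ext i
  simp only [refB, ketB, one_div_sqrt_two, sin_pi_div_eight_eq]
  generalize Real.cos (Real.pi / 8) = c at h1
  fin_cases b <;> fin_cases i <;> simp [pauliX, pauliZ, PiLp.inner_apply, Fin.sum_univ_two,
      -inner_self_eq_norm_sq_to_K] <;> grind

theorem inner_ketA (p q : Fin 2 × Fin 2) : ⟪ketA p.1 p.2, ketA q.1 q.2⟫_ℂ =
    ((if p.1 = q.1 then if p.2 = q.2 then 1 else 0
      else if p = (0, 0) ∨ q = (0, 0) then √2 / 2 else
        if p = (0, 1) ∧ q.2 = 0 ∨ q = (0, 1) ∧ p.2 = 0 then -(√2 / 2) else √2 / 2 : ℝ) : ℂ) := by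
  have h2 := ofReal_sqrt_two_sq
  obtain ⟨x, a⟩ := p
  obtain ⟨y, b⟩ := q
  simp only [ketA, one_div_sqrt_two]
  fin_cases x <;> fin_cases y <;> fin_cases a <;> fin_cases b <;>
    simp [PiLp.inner_apply, Fin.sum_univ_two, map_ofNat, -inner_self_eq_norm_sq_to_K] <;> grind

theorem inner_ketB (p q : Fin 2 × Fin 2) : ⟪ketB p.1 p.2, ketB q.1 q.2⟫_ℂ =
    ((if p.1 = q.1 then if p.2 = q.2 then 1 else 0
      else if p.2 = 0 ∧ q.2 = 0 then √2 / 2 else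
        if p.2 = 1 ∧ q.2 = 1 then √2 / 2 else if p = (0, 1) ∨ q = (0, 1) then √2 / 2
          else -(√2 / 2) : ℝ) : ℂ) := by
  have h2 := ofReal_sqrt_two_sq
  have h1 : ((Real.cos (Real.pi / 8) : ℝ) : ℂ) ^ 2 = (2 + (√2 : ℝ)) / 4 := by
    rw [← Complex.ofReal_pow, cos_pi_div_eight_sq]
    norm_num
  obtain ⟨x, a⟩ := p
  obtain ⟨y, b⟩ := q
  simp only [ketB, sin_pi_div_eight_eq]
  generalize Real.cos (Real.pi / 8) = c at h1
  fin_cases x <;> fin_cases y <;> fin_cases a <;> fin_cases b <;>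
    simp [PiLp.inner_apply, Fin.sum_univ_two, -inner_self_eq_norm_sq_to_K] <;> grind

/-- A rank-one projector sends the state to its overlap with the product vector times that vector.
The overlap is `√χ` up to a sign, which is negative only for the first event and is absorbed in
`refVec`. -/
theorem mapL_ref_refState (i : Fin 8) :
    TensorProduct.mapL (refA (event i).x (event i).a) (refB (event i).y (event i).b) refState
      = ((√chi : ℝ) : ℂ) • refVec i := by
  have h2 := ofReal_sqrt_two_sq
  simp only [refState, map_smul, map_add, TensorProduct.mapL_tmul, refA, refB,
    InnerProductSpace.rankOne_apply, TensorProduct.smul_tmul_smul, ← add_smul, smul_smul, refVec]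
  congr 1
  rw [sqrt_chi, div_eq_mul_one_div, one_div_sqrt_two]
  simp only [ketA, ketB, sin_pi_div_eight_eq, one_div_sqrt_two]
  generalize Real.cos (Real.pi / 8) = c
  fin_cases i <;> simp [event, PiLp.inner_apply, Fin.sum_univ_two, map_ofNat,
      -inner_self_eq_norm_sq_to_K] <;> grind


theorem norm_ketA (x a : Fin 2) : ‖ketA x a‖ = 1 := by
  have h := inner_self_eq_norm_sq (𝕜 := ℂ) (ketA x a)
  rw [inner_ketA (x, a) (x, a)] at h
  exact (pow_eq_one_iff_of_nonneg (norm_nonneg _) two_ne_zero).1 (by simpa using h.symm)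

theorem norm_ketB (y b : Fin 2) : ‖ketB y b‖ = 1 := by
  have h := inner_self_eq_norm_sq (𝕜 := ℂ) (ketB y b)
  rw [inner_ketB (y, b) (y, b)] at h
  exact (pow_eq_one_iff_of_nonneg (norm_nonneg _) two_ne_zero).1 (by simpa using h.symm)

theorem isProjectiveMeasurements_refA : IsProjectiveMeasurements refA := by
  refine fun x => ⟨fun a => InnerProductSpace.isStarProjection_rankOne_self (norm_ketA x a), ?_⟩
  ext1 e
  fin_cases x
  · simp only [Fin.zero_eta, Fin.isValue, _root_.add_apply, refA_zero]
    simp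
    module
  · simp only [Fin.mk_one, Fin.isValue, _root_.add_apply, refA_one]
    simp
    module

theorem isProjectiveMeasurements_refB : IsProjectiveMeasurements refB := by
  refine fun x => ⟨fun a => InnerProductSpace.isStarProjection_rankOne_self (norm_ketB x a), ?_⟩
  ext1 e
  fin_cases x
  · simp only [Fin.zero_eta, Fin.isValue, _root_.add_apply, refB_zero]
    simp
    module
  · simp only [Fin.mk_one, Fin.isValue, _root_.add_apply, refB_one]
    simp
    module

section TensorInner

variable {E F : Type*} [NormedAddCommGroup E] [InnerProductSpace ℂ E]
  [NormedAddCommGroup F] [InnerProductSpace ℂ F]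

theorem tensor_inner_smul_left (c : ℂ) (x y : E ⊗[ℂ] F) :
    ⟪c • x, y⟫_ℂ = starRingEnd ℂ c * ⟪x, y⟫_ℂ := inner_smul_left x y c

theorem tensor_inner_smul_right (c : ℂ) (x y : E ⊗[ℂ] F) :
    ⟪x, c • y⟫_ℂ = c * ⟪x, y⟫_ℂ := inner_smul_right x y c

theorem tensor_inner_add_left (x y z : E ⊗[ℂ] F) :
    ⟪x + y, z⟫_ℂ = ⟪x, z⟫_ℂ + ⟪y, z⟫_ℂ := inner_add_left x y z

theorem tensor_inner_add_right (x y z : E ⊗[ℂ] F) :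
    ⟪x, y + z⟫_ℂ = ⟪x, y⟫_ℂ + ⟪x, z⟫_ℂ := inner_add_right x y z

theorem tensor_inner_zero_left (x : E ⊗[ℂ] F) : ⟪(0 : E ⊗[ℂ] F), x⟫_ℂ = 0 :=
  inner_zero_left (𝕜 := ℂ) x

theorem tensor_inner_zero_right (x : E ⊗[ℂ] F) : ⟪x, (0 : E ⊗[ℂ] F)⟫_ℂ = 0 :=
  inner_zero_right (𝕜 := ℂ) x

end TensorInner

theorem inner_refState_self : ⟪refState, refState⟫_ℂ = 1 := by
  have h2 := ofReal_sqrt_two_sq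
  simp only [refState, one_div_sqrt_two, tensor_inner_smul_left, tensor_inner_smul_right,
      tensor_inner_add_left,
    tensor_inner_add_right, TensorProduct.inner_tmul]
  simp [PiLp.inner_apply, Fin.sum_univ_two, map_ofNat, -inner_self_eq_norm_sq_to_K]
  grind

theorem isRealization_ref :
    IsRealization refA refB (refState : HilbertTensor Qubit Qubit) := by
  refine ⟨isProjectiveMeasurements_refA, isProjectiveMeasurements_refB, ?_⟩
  rw [UniformSpace.Completion.norm_coe, norm_eq_sqrt_re_inner (𝕜 := ℂ), inner_refState_self]
  simp

theorem chi_pos : 0 < chi := by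
  unfold chi
  positivity

theorem inner_refVec (i j : Fin 8) :
    ((chi : ℝ) : ℂ) * ⟪refVec i, refVec j⟫_ℂ = (matP i.succ j.succ : ℂ) := by
  have hA := fun i j => inner_ketA ((event i).x, (event i).a) ((event j).x, (event j).a)
  have hB := fun i j => inner_ketB ((event i).y, (event i).b) ((event j).y, (event j).b)
  simp only at hA hB
  have h2 := ofReal_sqrt_two_sq
  simp only [refVec, tensor_inner_smul_left, tensor_inner_smul_right, TensorProduct.inner_tmul,
      hA, hB]
  clear hA hB
  fin_cases i <;> fin_cases j <;> simp [event, matP, chi] <;> grind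

theorem eventVec_ref (i : Fin 8) :
    eventVec refA refB (refState : HilbertTensor Qubit Qubit) (event i)
      = ((((√chi : ℝ) : ℂ) • refVec i : Qubit ⊗[ℂ] Qubit) : HilbertTensor Qubit Qubit) := by
  rw [eventVec, opTensor_coe, mapL_ref_refState]

theorem inner_refState_refVec (i : Fin 8) :
    ⟪refState, refVec i⟫_ℂ = ((√chi : ℝ) : ℂ) := by
  have h2 := ofReal_sqrt_two_sq
  rw [sqrt_chi, div_eq_mul_one_div, refState, one_div_sqrt_two]
  simp only [tensor_inner_smul_left, refVec, tensor_inner_smul_right, tensor_inner_add_left,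
      TensorProduct.inner_tmul]
  simp only [ketA, ketB, sin_pi_div_eight_eq, one_div_sqrt_two]
  generalize Real.cos (Real.pi / 8) = c
  fin_cases i <;> simp [event, PiLp.inner_apply, Fin.sum_univ_two, map_ofNat,
    -inner_self_eq_norm_sq_to_K] <;> grind

theorem sqrt_chi_mul_self : ((√chi : ℝ) : ℂ) * ((√chi : ℝ) : ℂ) = (chi : ℂ) := by
  rw [← Complex.ofReal_mul, Real.mul_self_sqrt chi_pos.le]

theorem matP_zero_succ (i : Fin 8) : matP 0 i.succ = chi := by
  fin_cases i <;> rfl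

theorem matP_succ_zero (i : Fin 8) : matP i.succ 0 = chi := by
  fin_cases i <;> rfl

theorem matP_succ_self (i : Fin 8) : matP i.succ i.succ = chi := by
  fin_cases i <;> rfl

theorem gram_ref :
    Matrix.gram ℂ (Fin.cons (refState : HilbertTensor Qubit Qubit)
      (fun i : Fin 8 => eventVec refA refB (refState : HilbertTensor Qubit Qubit) (event i)) :
        Fin 9 → HilbertTensor Qubit Qubit)
      = matP.map ((↑) : ℝ → ℂ) := by
  ext p q
  rw [Matrix.gram_apply, Matrix.map_apply]
  refine Fin.cases ?_ (fun p => ?_) p <;> refine Fin.cases ?_ (fun q => ?_) q <;>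
    simp only [Fin.cons_zero, Fin.cons_succ, eventVec_ref, UniformSpace.Completion.inner_coe,
      tensor_inner_smul_left, tensor_inner_smul_right, Complex.conj_ofReal, matP_zero_succ,
          matP_succ_zero]
  · rw [inner_refState_self]
    simp [matP]
  · rw [inner_refState_refVec, sqrt_chi_mul_self]
  · rw [show ⟪refVec p, refState⟫_ℂ = starRingEnd ℂ ⟪refState, refVec p⟫_ℂ from
      (inner_conj_symm (𝕜 := ℂ) (refVec p) refState).symm, inner_refState_refVec,
          Complex.conj_ofReal, sqrt_chi_mul_self]
  · rw [← mul_assoc, sqrt_chi_mul_self, inner_refVec]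

theorem witness_ref : witness refA refB (refState : HilbertTensor Qubit Qubit) = 2 + √2 := by
  have h : ∀ i, prob refA refB (refState : HilbertTensor Qubit Qubit) (event i) = chi := by
    intro i
    rw [prob, eventVec_ref, UniformSpace.Completion.inner_coe, tensor_inner_smul_right,
      inner_refState_refVec, sqrt_chi_mul_self, Complex.ofReal_re]
  simp [witness, h, chi]
  ring

open scoped ComplexOrder in
-- A complex Gram matrix with real entries is semidefinite on real vectors in particular.
theorem posSemidef_matP : matP.PosSemidef := by
  have h := Matrix.posSemidef_gram ℂ (Fin.cons (refState : HilbertTensor Qubit Qubit)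
      (fun i : Fin 8 => eventVec refA refB (refState : HilbertTensor Qubit Qubit) (event i)) :
        Fin 9 → HilbertTensor Qubit Qubit)
  rw [gram_ref] at h
  refine Matrix.PosSemidef.of_dotProduct_mulVec_nonneg ?_ fun x => ?_
  · ext p q
    have := h.isHermitian.apply p q
    simpa using this
  · have h1 := h.dotProduct_mulVec_nonneg (fun i => (x i : ℂ))
    have h2 : star (fun i => (x i : ℂ)) ⬝ᵥ (matP.map ((↑) : ℝ → ℂ)).mulVec (fun i => (x i : ℂ))
        = ((star x ⬝ᵥ matP.mulVec x : ℝ) : ℂ) := by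
      simp [dotProduct, Matrix.mulVec]
    rw [h2] at h1
    exact_mod_cast h1

/-! ### Optimality of `matP` and `matZ`. -/

theorem thetaFeasible_matP : ThetaFeasible ci8 matP := by
  refine ⟨posSemidef_matP, rfl, fun i => ?_, fun i j h => ?_⟩
  · rw [matP_succ_self, matP_zero_succ]
  · rw [ci8_adj_iff] at h
    rcases h with rfl | rfl | rfl <;> fin_cases i <;> rfl

theorem thetaObjective_matP : thetaObjective (fun _ => 1) matP = 2 + √2 := by
  simp [thetaObjective, matP_succ_self, chi]
  ring

theorem isGreatest_thetaValues : IsGreatest (thetaValues ci8 (fun _ => 1)) (2 + √2) := by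
  refine ⟨⟨matP, thetaFeasible_matP, thetaObjective_matP⟩, ?_⟩
  rintro r ⟨X, hX, rfl⟩
  exact weak_duality dualFeasible_matZ hX

theorem isThetaOptimal_iff (X : Matrix (Fin 9) (Fin 9) ℝ) :
    IsThetaOptimal ci8 (fun _ => 1) X ↔ X = matP := by
  refine ⟨fun h => ?_, ?_⟩
  · refine eq_of_dualNondegenerate dualFeasible_matZ dualNondegenerate_matZ h.1 thetaFeasible_matP
      (le_antisymm (weak_duality dualFeasible_matZ h.1) ?_) thetaObjective_matP
    rw [← thetaObjective_matP]
    exact h.2 _ thetaFeasible_matP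
  · rintro rfl
    refine ⟨thetaFeasible_matP, fun Y hY => ?_⟩
    rw [thetaObjective_matP]
    exact weak_duality dualFeasible_matZ hY

theorem isDualOptimal_matZ : IsDualOptimal ci8 (fun _ => 1) (2 + √2) matZ := by
  refine ⟨dualFeasible_matZ, fun s Y hY => ?_⟩
  rw [← thetaObjective_matP]
  exact weak_duality hY thetaFeasible_matP


/-! ### Operators on Hilbert space tensor products, and slices of vectors. -/

section TensorOperators

variable {E F G H G' H' : Type*} [NormedAddCommGroup E] [InnerProductSpace ℂ E]
  [NormedAddCommGroup F] [InnerProductSpace ℂ F] [NormedAddCommGroup G] [InnerProductSpace ℂ G]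
  [NormedAddCommGroup H] [InnerProductSpace ℂ H] [NormedAddCommGroup G'] [InnerProductSpace ℂ G']
  [NormedAddCommGroup H'] [InnerProductSpace ℂ H']

theorem opTensor_opTensor (S' : G →L[ℂ] G') (T' : H →L[ℂ] H') (S : E →L[ℂ] G) (T : F →L[ℂ] H)
    (x : HilbertTensor E F) :
    opTensor S' T' (opTensor S T x) = opTensor (S' ∘L S) (T' ∘L T) x := by
  have : opTensor S' T' ∘L opTensor S T = opTensor (S' ∘L S) (T' ∘L T) := by
    refine opTensor_ext fun z => ?_
    rw [ContinuousLinearMap.comp_apply, opTensor_coe, opTensor_coe, opTensor_coe,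
      TensorProduct.mapL_comp, ContinuousLinearMap.comp_apply]
  exact congrArg (fun f => f x) this

theorem opTensor_one_one (x : HilbertTensor E F) : opTensor (1 : E →L[ℂ] E) (1 : F →L[ℂ] F) x =
    x := by
  have : opTensor (1 : E →L[ℂ] E) (1 : F →L[ℂ] F) = 1 := by
    refine opTensor_ext fun z => ?_
    rw [opTensor_coe]
    simp [ContinuousLinearMap.one_def]
  rw [this]
  rfl

theorem hilbertTensor_ext {x y : HilbertTensor E F}
    (h : ∀ (e : E) (f : F), ⟪((e ⊗ₜ[ℂ] f : E ⊗[ℂ] F) : HilbertTensor E F), x⟫_ℂ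
      = ⟪((e ⊗ₜ[ℂ] f : E ⊗[ℂ] F) : HilbertTensor E F), y⟫_ℂ) : x = y := by
  refine ext_inner_left ℂ fun v => ?_
  induction v using UniformSpace.Completion.induction_on with
  | hp => exact isClosed_eq (by fun_prop) (by fun_prop)
  | ih z =>
    induction z using TensorProduct.induction_on with
    | zero => rw [UniformSpace.Completion.coe_zero, inner_zero_left, inner_zero_left]
    | tmul e f => exact h e f
    | add z w hz hw => rw [UniformSpace.Completion.coe_add, inner_add_left, inner_add_left, hz, hw]

theorem inner_opTensor_left [CompleteSpace E] [CompleteSpace F] [CompleteSpace G] [CompleteSpace H]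
    (S : E →L[ℂ] G) (T : F →L[ℂ] H) (x : HilbertTensor E F) (y : HilbertTensor G H) :
    ⟪opTensor S T x, y⟫_ℂ = ⟪x, opTensor S.adjoint T.adjoint y⟫_ℂ := by
  induction x, y using UniformSpace.Completion.induction_on₂ with
  | hp => exact isClosed_eq (by fun_prop) (by fun_prop)
  | ih z w =>
    rw [opTensor_coe, opTensor_coe, UniformSpace.Completion.inner_coe,
      UniformSpace.Completion.inner_coe]
    induction z using TensorProduct.induction_on with
    | zero => rw [map_zero, tensor_inner_zero_left, tensor_inner_zero_left]
    | add z z' hz hz' => rw [map_add, tensor_inner_add_left, tensor_inner_add_left, hz, hz']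
    | tmul e f =>
      induction w using TensorProduct.induction_on with
      | zero => rw [map_zero, tensor_inner_zero_right, tensor_inner_zero_right]
      | add w w' hw hw' => rw [map_add, tensor_inner_add_right, tensor_inner_add_right, hw, hw']
      | tmul g h =>
        rw [TensorProduct.mapL_tmul, TensorProduct.mapL_tmul, TensorProduct.inner_tmul,
          TensorProduct.inner_tmul, ContinuousLinearMap.adjoint_inner_right,
          ContinuousLinearMap.adjoint_inner_right]

/-- The map `e ↦ e ⊗ f`. -/
def tmulRight (E : Type*) [NormedAddCommGroup E] [InnerProductSpace ℂ E] (f : F) :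
    E →L[ℂ] HilbertTensor E F :=
  UniformSpace.Completion.toComplL ∘L (TensorProduct.mkL ℂ E F).flip f

/-- The map `f ↦ e ⊗ f`. -/
def tmulLeft (F : Type*) [NormedAddCommGroup F] [InnerProductSpace ℂ F] (e : E) :
    F →L[ℂ] HilbertTensor E F :=
  UniformSpace.Completion.toComplL ∘L TensorProduct.mkL ℂ E F e

theorem tmulRight_apply (e : E) (f : F) :
    tmulRight E f e = ((e ⊗ₜ[ℂ] f : E ⊗[ℂ] F) : HilbertTensor E F) := rfl

theorem tmulLeft_apply (e : E) (f : F) :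
    tmulLeft F e f = ((e ⊗ₜ[ℂ] f : E ⊗[ℂ] F) : HilbertTensor E F) := rfl

variable [CompleteSpace E] [CompleteSpace F]

/-- The adjoint of `e ↦ e ⊗ f` is the partial inner product with `f`; acting on the second factor
only, it commutes with operators on the first. Relations that hold on a tensor thus pass to its
slices. -/
theorem adjoint_tmulRight_opTensor (T : E →L[ℂ] E) (f : F) (x : HilbertTensor E F) :
    (tmulRight E f).adjoint (opTensor T 1 x) = T ((tmulRight E f).adjoint x) := by
  refine ext_inner_right ℂ fun e => ?_
  rw [ContinuousLinearMap.adjoint_inner_left, inner_opTensor_left, tmulRight_apply, opTensor_coe,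
    TensorProduct.mapL_tmul, ← ContinuousLinearMap.adjoint_inner_right T,
    ContinuousLinearMap.adjoint_inner_left, tmulRight_apply, ContinuousLinearMap.adjoint_one]
  rfl

theorem adjoint_tmulLeft_opTensor (T : F →L[ℂ] F) (e : E) (x : HilbertTensor E F) :
    (tmulLeft F e).adjoint (opTensor 1 T x) = T ((tmulLeft F e).adjoint x) := by
  refine ext_inner_right ℂ fun f => ?_
  rw [ContinuousLinearMap.adjoint_inner_left, inner_opTensor_left, tmulLeft_apply, opTensor_coe,
    TensorProduct.mapL_tmul, ← ContinuousLinearMap.adjoint_inner_right T,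
    ContinuousLinearMap.adjoint_inner_left, tmulLeft_apply, ContinuousLinearMap.adjoint_one]
  rfl

/-- A vector all of whose left slices lie in `K` is fixed by `P_K ⊗ 1`. -/
theorem opTensor_starProjection_one (K : Submodule ℂ E) [K.HasOrthogonalProjection]
    {x : HilbertTensor E F} (h : ∀ f, (tmulRight E f).adjoint x ∈ K) :
    opTensor K.starProjection 1 x = x := by
  refine hilbertTensor_ext fun e f => ?_
  rw [← tmulRight_apply, ← ContinuousLinearMap.adjoint_inner_right,
    ← ContinuousLinearMap.adjoint_inner_right, adjoint_tmulRight_opTensor,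
    Submodule.starProjection_eq_self_iff.2 (h f)]

/-- A vector all of whose right slices lie in `L` is fixed by `1 ⊗ P_L`. -/
theorem opTensor_one_starProjection (L : Submodule ℂ F) [L.HasOrthogonalProjection]
    {x : HilbertTensor E F} (h : ∀ e, (tmulLeft F e).adjoint x ∈ L) :
    opTensor 1 L.starProjection x = x := by
  refine hilbertTensor_ext fun e f => ?_
  rw [← tmulLeft_apply, ← ContinuousLinearMap.adjoint_inner_right,
    ← ContinuousLinearMap.adjoint_inner_right, adjoint_tmulLeft_opTensor,
    Submodule.starProjection_eq_self_iff.2 (h e)]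

end TensorOperators

/-! ### The qubit carried by a pair of self-adjoint operators. -/

section QubitExtraction

variable {H : Type*} [NormedAddCommGroup H] [InnerProductSpace ℂ H]

/-- The vectors on which `Z` is `1` and `X` acts as a flip to the eigenvalue `-1`. -/
def qubitSpace (Z X : H →L[ℂ] H) : Submodule ℂ H where
  carrier := {v | Z v = v ∧ Z (X v) = -X v ∧ X (X v) = v}
  zero_mem' := by simp
  add_mem' := by
    rintro v w ⟨h1, h2, h3⟩ ⟨k1, k2, k3⟩
    refine ⟨?_, ?_, ?_⟩
    · rw [map_add, h1, k1]
    · rw [map_add, map_add, h2, k2, neg_add]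
    · rw [map_add, map_add, h3, k3]
  smul_mem' := by
    rintro c v ⟨h1, h2, h3⟩
    refine ⟨?_, ?_, ?_⟩
    · rw [map_smul, h1]
    · rw [map_smul, map_smul, h2, smul_neg]
    · rw [map_smul, map_smul, h3]

theorem mem_qubitSpace {Z X : H →L[ℂ] H} {v : H} :
    v ∈ qubitSpace Z X ↔ Z v = v ∧ Z (X v) = -X v ∧ X (X v) = v := Iff.rfl

theorem isClosed_qubitSpace (Z X : H →L[ℂ] H) : IsClosed (qubitSpace Z X : Set H) :=
  (isClosed_eq (by fun_prop) (by fun_prop)).inter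
    ((isClosed_eq (by fun_prop) (by fun_prop)).inter (isClosed_eq (by fun_prop) (by fun_prop)))

/-- The linear map `e ⊗ k ↦ e₀ k + e₁ X k`. -/
def qubitLinear (Z X : H →L[ℂ] H) : Qubit ⊗[ℂ] qubitSpace Z X →ₗ[ℂ] H :=
  TensorProduct.lift <| LinearMap.mk₂ ℂ (fun (e : Qubit) (k : qubitSpace Z X) =>
      e 0 • (k : H) + e 1 • X k)
    (fun e e' k => by simp only [PiLp.add_apply]; module)
    (fun c e k => by simp only [PiLp.smul_apply, smul_eq_mul]; module)
    (fun e k k' => by simp only [Submodule.coe_add, map_add]; module)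
    (fun c e k => by simp only [Submodule.coe_smul, map_smul]; module)

theorem qubitLinear_tmul (Z X : H →L[ℂ] H) (e : Qubit) (k : qubitSpace Z X) :
    qubitLinear Z X (e ⊗ₜ[ℂ] k) = e 0 • (k : H) + e 1 • X k := rfl

variable [CompleteSpace H]

instance (Z X : H →L[ℂ] H) : CompleteSpace (qubitSpace Z X) :=
  (isClosed_qubitSpace Z X).completeSpace_coe

/-- For `k`, `l` in the qubit space, `k` and `X l` have eigenvalues `1` and `-1` under the
self-adjoint `Z`, hence are orthogonal, and `⟪X k, X l⟫ = ⟪k, X X l⟫ = ⟪k, l⟫`. -/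
theorem inner_qubitLinear {Z X : H →L[ℂ] H} (hZ : IsSelfAdjoint Z) (hX : IsSelfAdjoint X)
    (x y : Qubit ⊗[ℂ] qubitSpace Z X) :
    ⟪qubitLinear Z X x, qubitLinear Z X y⟫_ℂ = ⟪x, y⟫_ℂ := by
  have sZ : ∀ v w, ⟪Z v, w⟫_ℂ = ⟪v, Z w⟫_ℂ := hZ.isSymmetric
  have sX : ∀ v w, ⟪X v, w⟫_ℂ = ⟪v, X w⟫_ℂ := hX.isSymmetric
  induction x using TensorProduct.induction_on with
  | zero => rw [map_zero, inner_zero_left, tensor_inner_zero_left]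
  | add x x' hx hx' => rw [map_add, inner_add_left, tensor_inner_add_left, hx, hx']
  | tmul e k =>
    induction y using TensorProduct.induction_on with
    | zero => rw [map_zero, inner_zero_right, tensor_inner_zero_right]
    | add y y' hy hy' => rw [map_add, inner_add_right, tensor_inner_add_right, hy, hy']
    | tmul f l =>
      obtain ⟨k1, k2, k3⟩ := mem_qubitSpace.1 k.2
      obtain ⟨l1, l2, l3⟩ := mem_qubitSpace.1 l.2
      have hkl : ⟪(k : H), X l⟫_ℂ = 0 := by
        have h := sZ k (X l)
        rw [k1, l2, inner_neg_right] at h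
        exact self_eq_neg.1 h
      have hXX : ⟪X (k : H), X l⟫_ℂ = ⟪(k : H), l⟫_ℂ := by rw [sX, l3]
      have hlk : ⟪X (k : H), l⟫_ℂ = 0 := by rw [sX, hkl]
      rw [qubitLinear_tmul, qubitLinear_tmul, TensorProduct.inner_tmul]
      simp only [inner_add_left, inner_add_right, inner_smul_left, inner_smul_right, hkl, hlk, hXX,
        PiLp.inner_apply, Fin.sum_univ_two, Submodule.coe_inner]
      simp
      ring

/-- The isometry `e ⊗ k ↦ e₀ k + e₁ X k`. -/
def qubitIsometry {Z X : H →L[ℂ] H} (hZ : IsSelfAdjoint Z) (hX : IsSelfAdjoint X) :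
    Qubit ⊗[ℂ] qubitSpace Z X →ₗᵢ[ℂ] H :=
  ⟨qubitLinear Z X, fun x => by
    rw [norm_eq_sqrt_re_inner (𝕜 := ℂ), norm_eq_sqrt_re_inner (𝕜 := ℂ), inner_qubitLinear hZ hX]⟩

variable {Z X : H →L[ℂ] H} (hZ : IsSelfAdjoint Z) (hX : IsSelfAdjoint X)

theorem qubitIsometry_tmul (e : Qubit) (k : qubitSpace Z X) :
    qubitIsometry hZ hX (e ⊗ₜ[ℂ] k) = e 0 • (k : H) + e 1 • X k := rfl

theorem qubitIsometry_pauliZ (e : Qubit) (k : qubitSpace Z X) :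
    qubitIsometry hZ hX (pauliZ e ⊗ₜ[ℂ] k) = Z (qubitIsometry hZ hX (e ⊗ₜ[ℂ] k)) := by
  obtain ⟨k1, k2, k3⟩ := mem_qubitSpace.1 k.2
  rw [qubitIsometry_tmul, qubitIsometry_tmul, map_add, map_smul, map_smul, k1, k2]
  simp [pauliZ]

theorem qubitIsometry_pauliX (e : Qubit) (k : qubitSpace Z X) :
    qubitIsometry hZ hX (pauliX e ⊗ₜ[ℂ] k) = X (qubitIsometry hZ hX (e ⊗ₜ[ℂ] k)) := by
  obtain ⟨k1, k2, k3⟩ := mem_qubitSpace.1 k.2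
  rw [qubitIsometry_tmul, qubitIsometry_tmul, map_add, map_smul, map_smul, k3]
  simp [pauliX, add_comm]

end QubitExtraction

/-! ### Local isometries and the extraction of the entangled pair. -/

section LocalImage

variable {E F G H K L : Type*} [NormedAddCommGroup E] [InnerProductSpace ℂ E]
  [NormedAddCommGroup F] [InnerProductSpace ℂ F] [NormedAddCommGroup G] [InnerProductSpace ℂ G]
  [NormedAddCommGroup H] [InnerProductSpace ℂ H] [NormedAddCommGroup K] [InnerProductSpace ℂ K]
  [NormedAddCommGroup L] [InnerProductSpace ℂ L]

theorem localImage_tmul (V : E ⊗[ℂ] K →ₗᵢ[ℂ] G) (W : F ⊗[ℂ] L →ₗᵢ[ℂ] H) (κ : HilbertTensor K L)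
    (e : E) (f : F) : localImage V W κ (e ⊗ₜ[ℂ] f)
      = opTensor (V.toContinuousLinearMap ∘L TensorProduct.mkL ℂ E K e)
      (W.toContinuousLinearMap ∘L TensorProduct.mkL ℂ F L f) κ := rfl

theorem localImage_mapL {V : E ⊗[ℂ] K →ₗᵢ[ℂ] G} {W : F ⊗[ℂ] L →ₗᵢ[ℂ] H} (κ : HilbertTensor K L)
    {S : E →L[ℂ] E} {T : F →L[ℂ] F} {S' : G →L[ℂ] G} {T' : H →L[ℂ] H}
    (hS : ∀ e k, V (S e ⊗ₜ[ℂ] k) = S' (V (e ⊗ₜ[ℂ] k)))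
    (hT : ∀ f l, W (T f ⊗ₜ[ℂ] l) = T' (W (f ⊗ₜ[ℂ] l))) (z : E ⊗[ℂ] F) :
    localImage V W κ (TensorProduct.mapL S T z) = opTensor S' T' (localImage V W κ z) := by
  induction z using TensorProduct.induction_on with
  | zero => simp
  | add z w hz hw => rw [map_add, map_add, map_add, map_add, hz, hw]
  | tmul e f =>
    rw [TensorProduct.mapL_tmul, localImage_tmul, localImage_tmul, opTensor_opTensor]
    congr 2
    · ext k
      exact hS e k
    · ext l
      exact hT f l

end LocalImage


section Extraction

variable {HA HB : Type*} [NormedAddCommGroup HA] [InnerProductSpace ℂ HA]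
  [NormedAddCommGroup HB] [InnerProductSpace ℂ HB]

theorem opTensor_comm (S : HA →L[ℂ] HA) (T : HB →L[ℂ] HB) (v : HilbertTensor HA HB) :
    opTensor S (1 : HB →L[ℂ] HB) (opTensor (1 : HA →L[ℂ] HA) T v)
        = opTensor (1 : HA →L[ℂ] HA) T (opTensor S (1 : HB →L[ℂ] HB) v) := by
  rw [opTensor_opTensor, opTensor_opTensor]
  rfl

theorem opTensor_eq_comp (S : HA →L[ℂ] HA) (T : HB →L[ℂ] HB) (v : HilbertTensor HA HB) :
    opTensor S T v = opTensor S (1 : HB →L[ℂ] HB) (opTensor (1 : HA →L[ℂ] HA) T v) := by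
  rw [opTensor_opTensor]
  rfl

variable [CompleteSpace HA] [CompleteSpace HB]

theorem inner_opTensor_one_left {S : HA →L[ℂ] HA} (hS : IsSelfAdjoint S)
    (v w : HilbertTensor HA HB) :
    ⟪opTensor S (1 : HB →L[ℂ] HB) v, w⟫_ℂ = ⟪v, opTensor S (1 : HB →L[ℂ] HB) w⟫_ℂ := by
  rw [inner_opTensor_left, hS.adjoint_eq, ContinuousLinearMap.adjoint_one]

theorem inner_one_opTensor_left {S : HB →L[ℂ] HB} (hS : IsSelfAdjoint S)
    (v w : HilbertTensor HA HB) :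
    ⟪opTensor (1 : HA →L[ℂ] HA) S v, w⟫_ℂ = ⟪v, opTensor (1 : HA →L[ℂ] HA) S w⟫_ℂ := by
  rw [inner_opTensor_left, hS.adjoint_eq, ContinuousLinearMap.adjoint_one]

theorem adjoint_tmulRight_mem_qubitSpace {Z X : HA →L[ℂ] HA} (φ : HilbertTensor HA HB)
    (h1 : opTensor Z (1 : HB →L[ℂ] HB) φ = φ) (h2 : opTensor Z (1 : HB →L[ℂ] HB)
      (opTensor X (1 : HB →L[ℂ] HB) φ) = -opTensor X (1 : HB →L[ℂ] HB) φ)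
    (h3 : opTensor X (1 : HB →L[ℂ] HB) (opTensor X (1 : HB →L[ℂ] HB) φ) = φ) (f : HB) :
    (tmulRight HA f).adjoint φ ∈ qubitSpace Z X := by
  refine mem_qubitSpace.2 ⟨?_, ?_, ?_⟩
  · rw [← adjoint_tmulRight_opTensor, h1]
  · rw [← adjoint_tmulRight_opTensor, ← adjoint_tmulRight_opTensor, h2, map_neg]
  · rw [← adjoint_tmulRight_opTensor, ← adjoint_tmulRight_opTensor, h3]

theorem adjoint_tmulLeft_mem_qubitSpace {Z X : HB →L[ℂ] HB} (φ : HilbertTensor HA HB)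
    (h1 : opTensor (1 : HA →L[ℂ] HA) Z φ = φ)
      (h2 : opTensor (1 : HA →L[ℂ] HA) Z (opTensor (1 : HA →L[ℂ] HA) X φ)
      = -opTensor (1 : HA →L[ℂ] HA) X φ)
    (h3 : opTensor (1 : HA →L[ℂ] HA) X (opTensor (1 : HA →L[ℂ] HA) X φ) = φ) (e : HA) :
    (tmulLeft HB e).adjoint φ ∈ qubitSpace Z X := by
  refine mem_qubitSpace.2 ⟨?_, ?_, ?_⟩
  · rw [← adjoint_tmulLeft_opTensor, h1]
  · rw [← adjoint_tmulLeft_opTensor, ← adjoint_tmulLeft_opTensor, h2, map_neg]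
  · rw [← adjoint_tmulLeft_opTensor, ← adjoint_tmulLeft_opTensor, h3]

theorem localImage_refState {ZA XA : HA →L[ℂ] HA} {ZB XB : HB →L[ℂ] HB}
    (hZA : IsSelfAdjoint ZA) (hXA : IsSelfAdjoint XA) (hZB : IsSelfAdjoint ZB)
    (hXB : IsSelfAdjoint XB) (κ : HilbertTensor (qubitSpace ZA XA) (qubitSpace ZB XB)) :
    localImage (qubitIsometry hZA hXA) (qubitIsometry hZB hXB) κ refState
      = ((1 / √2 : ℝ) : ℂ) •
        (opTensor (qubitSpace ZA XA).subtypeL (qubitSpace ZB XB).subtypeL κ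
          + opTensor XA XB (opTensor (qubitSpace ZA XA).subtypeL (qubitSpace ZB XB).subtypeL κ))
              := by
  rw [refState, map_smul, map_add, localImage_tmul, localImage_tmul, opTensor_opTensor]
  congr 4
  · ext k
    exact (qubitIsometry_tmul hZA hXA _ k).trans (by simp)
  · ext k
    exact (qubitIsometry_tmul hZB hXB _ k).trans (by simp)
  · ext k
    exact (qubitIsometry_tmul hZA hXA _ k).trans (by simp)
  · ext k
    exact (qubitIsometry_tmul hZB hXB _ k).trans (by simp)

/-- If, on `ψ`, the operators `Z_A` and `X_A` agree with `Z_B` and `X_B`, square to the identity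
and anticommute, then `ψ` is the image of the maximally entangled state of the extracted qubits. -/
theorem exists_localImage_refState_eq {ZA XA : HA →L[ℂ] HA} {ZB XB : HB →L[ℂ] HB}
    (hZA : IsSelfAdjoint ZA) (hXA : IsSelfAdjoint XA) (hZB : IsSelfAdjoint ZB)
    (hXB : IsSelfAdjoint XB) {ψ : HilbertTensor HA HB} (hψ : ‖ψ‖ = 1)
    (hZ : opTensor ZA (1 : HB →L[ℂ] HB) ψ = opTensor (1 : HA →L[ℂ] HA) ZB ψ)
      (hX : opTensor XA (1 : HB →L[ℂ] HB) ψ = opTensor (1 : HA →L[ℂ] HA) XB ψ)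
    (hZZ : opTensor ZA (1 : HB →L[ℂ] HB) (opTensor ZA (1 : HB →L[ℂ] HB) ψ) = ψ)
      (hXX : opTensor XA (1 : HB →L[ℂ] HB) (opTensor XA (1 : HB →L[ℂ] HB) ψ) = ψ)
    (hZX : opTensor ZA (1 : HB →L[ℂ] HB) (opTensor XA (1 : HB →L[ℂ] HB) ψ)
      = -opTensor XA (1 : HB →L[ℂ] HB) (opTensor ZA (1 : HB →L[ℂ] HB) ψ)) :
    ∃ κ : HilbertTensor (qubitSpace ZA XA) (qubitSpace ZB XB), ‖κ‖ = 1 ∧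
      localImage (qubitIsometry hZA hXA) (qubitIsometry hZB hXB) κ refState = ψ := by
  have sa := inner_opTensor_one_left (HB := HB) hZA
  have sx := inner_opTensor_one_left (HB := HB) hXA
  have sy := inner_one_opTensor_left (HA := HA) hXB
  have cab := opTensor_comm ZA ZB
  have cay := opTensor_comm ZA XB
  have cxb := opTensor_comm XA ZB
  have cxy := opTensor_comm XA XB
  have hloc := localImage_refState hZA hXA hZB hXB
  have hr := adjoint_tmulRight_mem_qubitSpace (Z := ZA) (X := XA) (HB := HB)
  have hl := adjoint_tmulLeft_mem_qubitSpace (Z := ZB) (X := XB) (HA := HA)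
  have hxy := opTensor_eq_comp XA XB
  -- From here on the argument is about words in `a`, `x` (Alice) and `b`, `y` (Bob) applied to `ψ`.
  -- Alice's letters commute with Bob's everywhere; all other relations hold on `ψ` only, so letters
  -- are switched between the parties until the right one stands next to `ψ`.
  generalize opTensor ZA (1 : HB →L[ℂ] HB) = a at *
  generalize opTensor XA (1 : HB →L[ℂ] HB) = x at *
  generalize opTensor (1 : HA →L[ℂ] HA) ZB = b at *
  generalize opTensor (1 : HA →L[ℂ] HA) XB = y at *
  have yy : y (y ψ) = ψ := by rw [← hX, ← cxy, ← hX, hXX]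
  have bb : b (b ψ) = ψ := by rw [← hZ, ← cab, ← hZ, hZZ]
  have axa : a (x (a ψ)) = -x ψ := by rw [hZ, cxb, cab, hZX, map_neg, ← cxb, ← cab, ← hZ, hZZ]
  have xxa : x (x (a ψ)) = a ψ := by rw [hZ, cxb, cxb, hXX]
  have byψ : b (y ψ) = -y (b ψ) := by rw [← hX, ← cxb, ← hZ, ← cay, ← hX, hZX, neg_neg]
  have byb : b (y (b ψ)) = -y ψ := by rw [← hZ, ← cay, ← cab, byψ, map_neg, cay, cab, hZ, bb]
  have yya : y (y (b ψ)) = b ψ := by rw [← hZ, ← cay, ← cay, yy]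
  -- Anticommutation with `x` makes this inner product its own negative; it gives `‖φ‖² = 1/2`
  -- below.
  have aψ : ⟪ψ, a ψ⟫_ℂ = 0 := by
    have h : ⟪ψ, a ψ⟫_ℂ = -⟪ψ, a ψ⟫_ℂ := calc
      ⟪ψ, a ψ⟫_ℂ = ⟪x (x ψ), a ψ⟫_ℂ := by rw [hXX]
      _ = -⟪x ψ, a (x ψ)⟫_ℂ := by rw [sx, hZX, inner_neg_right, neg_neg]
      _ = -⟪ψ, a ψ⟫_ℂ := by rw [hX, sy, ← cay, yy]
    exact self_eq_neg.1 h
  set φ : HilbertTensor HA HB := (1 / 2 : ℂ) • (ψ + a ψ) with hφ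
  have hφ' : φ = (1 / 2 : ℂ) • (ψ + b ψ) := by rw [hφ, hZ]
  have φ1 : ∀ f, (tmulRight HA f).adjoint φ ∈ qubitSpace ZA XA := by
    refine hr φ ?_ ?_ ?_ <;> simp only [hφ, map_smul, map_add, hZZ, xxa, hXX, axa, hZX] <;> module
  have φ2 : ∀ e, (tmulLeft HB e).adjoint φ ∈ qubitSpace ZB XB := by
    refine hl φ ?_ ?_ ?_ <;> simp only [hφ', map_smul, map_add, bb, yya, yy, byb, byψ] <;> module
  have φproj : opTensor (qubitSpace ZA XA).starProjection (qubitSpace ZB XB).starProjection φ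
      = φ := by
    rw [opTensor_eq_comp, opTensor_one_starProjection _ φ2, opTensor_starProjection_one _ φ1]
  have φinner : ⟪φ, φ⟫_ℂ = 1 / 2 := by
    have h1 : ⟪ψ, ψ⟫_ℂ = 1 := by rw [inner_self_eq_norm_sq_to_K, hψ]; simp
    have h2 : ⟪a ψ, ψ⟫_ℂ = 0 := by rw [sa, aψ]
    have h3 : ⟪a ψ, a ψ⟫_ℂ = 1 := by rw [sa, hZZ, h1]
    simp only [hφ, inner_smul_left, inner_smul_right, inner_add_left, inner_add_right, h1, h2, h3,
        aψ]
    simp [map_ofNat]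
    norm_num
  -- `p` is `φ` regarded as an element of the tensor product of the two qubit spaces; the factor
  -- `√2` below normalizes it.
  set p := opTensor (qubitSpace ZA XA).orthogonalProjectionOnto
    (qubitSpace ZB XB).orthogonalProjectionOnto φ with hp
  have ιp : opTensor (qubitSpace ZA XA).subtypeL (qubitSpace ZB XB).subtypeL p = φ := by
    rw [hp, opTensor_opTensor]
    exact φproj
  have pinner : ⟪p, p⟫_ℂ = 1 / 2 := by
    conv_lhs => rw [hp]
    rw [inner_opTensor_left, Submodule.adjoint_orthogonalProjectionOnto,
      Submodule.adjoint_orthogonalProjectionOnto, ιp, φinner]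
  refine ⟨((√2 : ℝ) : ℂ) • p, ?_, ?_⟩
  · have h1 : ‖p‖ ^ 2 = 1 / 2 := by
      rw [← inner_self_eq_norm_sq (𝕜 := ℂ), pinner]
      simp
    refine (pow_eq_one_iff_of_nonneg (norm_nonneg _) two_ne_zero).1 ?_
    rw [norm_smul, mul_pow, h1, Complex.norm_real, Real.norm_of_nonneg (Real.sqrt_nonneg 2),
      sq_sqrt_two]
    norm_num
  · rw [hloc, map_smul, map_smul, ← smul_add, smul_smul, ιp, hxy, ← Complex.ofReal_mul,
      one_div_mul_cancel (by positivity), Complex.ofReal_one, one_smul, hφ']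
    -- `x y` fixes `ψ` and negates `b ψ`, so it sends `φ = (ψ + b ψ)/2` to `(ψ - b ψ)/2`; the two
    -- add up to `ψ`.
    have h1 : x (y ψ) = ψ := by rw [← hX, hXX]
    have h2 : x (y (b ψ)) = -b ψ := by
      rw [← hZ, ← cay, ← hX, hZX, map_neg, xxa]
    simp only [map_smul, map_add, h1, h2]
    module

end Extraction


/-! ### Observables and the sum-of-squares form of the witness. -/

section Observables

variable {H : Type*} [NormedAddCommGroup H] [InnerProductSpace ℂ H]

/-- The `±1`-valued observable of a two-outcome measurement. -/
def observable (P : Fin 2 → Fin 2 → H →L[ℂ] H) (x : Fin 2) : H →L[ℂ] H := P x 0 - P x 1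

variable [CompleteSpace H] {P : Fin 2 → Fin 2 → H →L[ℂ] H}

theorem IsProjectiveMeasurements.isSelfAdjoint_observable (hP : IsProjectiveMeasurements P)
    (x : Fin 2) : IsSelfAdjoint (observable P x) :=
  ((hP x).1 0).isSelfAdjoint.sub ((hP x).1 1).isSelfAdjoint

theorem IsProjectiveMeasurements.eq_observable (hP : IsProjectiveMeasurements P) (x a : Fin 2) :
    P x a = (1 / 2 : ℂ) • (1 + (-1 : ℂ) ^ (a : ℕ) • observable P x) := by
  rw [← (hP x).2, observable]
  fin_cases a <;> simp <;> module

theorem IsProjectiveMeasurements.observable_mul_self (hP : IsProjectiveMeasurements P)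
    (x : Fin 2) : observable P x * observable P x = 1 := by
  have h1 : P x 1 = 1 - P x 0 := eq_sub_of_add_eq' (hP x).2
  have h0 : P x 0 * P x 0 = P x 0 := ((hP x).1 0).isIdempotentElem
  rw [observable, h1]
  simp only [mul_sub, sub_mul, mul_one, one_mul, h0]
  abel

end Observables

section Witness

variable {HA HB : Type*} [NormedAddCommGroup HA] [InnerProductSpace ℂ HA]
  [NormedAddCommGroup HB] [InnerProductSpace ℂ HB]

/-- `(B₀ + B₁) / √2` -/
def obsZ (Q : Fin 2 → Fin 2 → HB →L[ℂ] HB) : HB →L[ℂ] HB :=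
  ((1 / √2 : ℝ) : ℂ) • (observable Q 0 + observable Q 1)

/-- `(B₀ - B₁) / √2` -/
def obsX (Q : Fin 2 → Fin 2 → HB →L[ℂ] HB) : HB →L[ℂ] HB :=
  ((1 / √2 : ℝ) : ℂ) • (observable Q 0 - observable Q 1)

theorem ofReal_one_div_sqrt_two_mul_self :
    ((1 / √2 : ℝ) : ℂ) * ((1 / √2 : ℝ) : ℂ) = 1 / 2 := by
  rw [← Complex.ofReal_mul, one_div_mul_one_div, Real.mul_self_sqrt (by norm_num)]
  norm_num

theorem observable_zero_eq (Q : Fin 2 → Fin 2 → HB →L[ℂ] HB) :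
    observable Q 0 = ((1 / √2 : ℝ) : ℂ) • (obsZ Q + obsX Q) := by
  rw [obsZ, obsX, ← smul_add, smul_smul, ofReal_one_div_sqrt_two_mul_self]
  module

theorem observable_one_eq (Q : Fin 2 → Fin 2 → HB →L[ℂ] HB) :
    observable Q 1 = ((1 / √2 : ℝ) : ℂ) • (obsZ Q - obsX Q) := by
  rw [obsZ, obsX, ← smul_sub, smul_smul, ofReal_one_div_sqrt_two_mul_self]
  module

variable [CompleteSpace HA] [CompleteSpace HB]
  {P : Fin 2 → Fin 2 → HA →L[ℂ] HA} {Q : Fin 2 → Fin 2 → HB →L[ℂ] HB} {ψ : HilbertTensor HA HB}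

theorem IsProjectiveMeasurements.isSelfAdjoint_obsZ (hQ : IsProjectiveMeasurements Q) :
    IsSelfAdjoint (obsZ Q) :=
  IsSelfAdjoint.smul (by simp [isSelfAdjoint_iff])
    ((hQ.isSelfAdjoint_observable 0).add (hQ.isSelfAdjoint_observable 1))

theorem IsProjectiveMeasurements.isSelfAdjoint_obsX (hQ : IsProjectiveMeasurements Q) :
    IsSelfAdjoint (obsX Q) :=
  IsSelfAdjoint.smul (by simp [isSelfAdjoint_iff])
    ((hQ.isSelfAdjoint_observable 0).sub (hQ.isSelfAdjoint_observable 1))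

/-- Since `B₀² = B₁² = 1`, the squares cancel in `(B₀ - B₁)(B₀ + B₁)` and only a commutator remains.
This is an operator identity, although `obsZ` and `obsX` need not square to `1`. -/
theorem IsProjectiveMeasurements.obsX_mul_obsZ (hQ : IsProjectiveMeasurements Q) :
    obsX Q * obsZ Q = -(obsZ Q * obsX Q) := by
  simp only [obsX, obsZ, smul_mul_smul_comm, sub_mul, mul_add, add_mul, mul_sub,
    hQ.observable_mul_self]
  module

omit [CompleteSpace HB] in
theorem opTensor_observable_sq (hP : IsProjectiveMeasurements P) (x : Fin 2)
    (v : HilbertTensor HA HB) : opTensor (observable P x) (1 : HB →L[ℂ] HB)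
      (opTensor (observable P x) (1 : HB →L[ℂ] HB) v) = v := by
  rw [opTensor_opTensor]
  change opTensor (observable P x * observable P x) (1 * 1 : HB →L[ℂ] HB) v = v
  rw [hP.observable_mul_self, one_mul, opTensor_one_one]

omit [CompleteSpace HA] in
theorem one_opTensor_observable_sq (hQ : IsProjectiveMeasurements Q) (y : Fin 2)
    (v : HilbertTensor HA HB) : opTensor (1 : HA →L[ℂ] HA) (observable Q y)
      (opTensor (1 : HA →L[ℂ] HA) (observable Q y) v) = v := by
  rw [opTensor_opTensor]
  change opTensor (1 * 1 : HA →L[ℂ] HA) (observable Q y * observable Q y) v = v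
  rw [hQ.observable_mul_self, one_mul, opTensor_one_one]

omit [CompleteSpace HA] [CompleteSpace HB] in
theorem one_opTensor_obsZ (v : HilbertTensor HA HB) :
    opTensor (1 : HA →L[ℂ] HA) (obsZ Q) v = ((1 / √2 : ℝ) : ℂ) •
      (opTensor (1 : HA →L[ℂ] HA) (observable Q 0) v
        + opTensor (1 : HA →L[ℂ] HA) (observable Q 1) v) := by
  rw [obsZ, opTensor_smul_right, opTensor_add_right, _root_.smul_apply, _root_.add_apply]

omit [CompleteSpace HA] [CompleteSpace HB] in
theorem one_opTensor_obsX (v : HilbertTensor HA HB) :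
    opTensor (1 : HA →L[ℂ] HA) (obsX Q) v = ((1 / √2 : ℝ) : ℂ) •
      (opTensor (1 : HA →L[ℂ] HA) (observable Q 0) v
        - opTensor (1 : HA →L[ℂ] HA) (observable Q 1) v) := by
  rw [obsX, opTensor_smul_right, sub_eq_add_neg, ← neg_one_smul ℂ, opTensor_add_right,
    opTensor_smul_right, _root_.smul_apply, _root_.add_apply, _root_.smul_apply, neg_one_smul,
    ← sub_eq_add_neg]

theorem eventVec_eq (hP : IsProjectiveMeasurements P) (hQ : IsProjectiveMeasurements Q)
    (e : Event) :
    eventVec P Q ψ e = (1 / 4 : ℂ) • (ψ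
      + (-1 : ℂ) ^ (e.a : ℕ) • opTensor (observable P e.x) (1 : HB →L[ℂ] HB) ψ
      + (-1 : ℂ) ^ (e.b : ℕ) • opTensor (1 : HA →L[ℂ] HA) (observable Q e.y) ψ
      + ((-1 : ℂ) ^ (e.a : ℕ) * (-1 : ℂ) ^ (e.b : ℕ)) •
        opTensor (observable P e.x) (observable Q e.y) ψ) := by
  rw [eventVec, hP.eq_observable, hQ.eq_observable]
  simp only [opTensor_smul_left, opTensor_smul_right, opTensor_add_left, opTensor_add_right,
    _root_.smul_apply, _root_.add_apply, opTensor_one_one]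
  module

/-- The sum-of-squares decomposition behind Tsirelson's bound. -/
theorem witness_eq (h : IsRealization P Q ψ) : witness P Q ψ = 2 + √2 - √2 / 4 *
    (‖opTensor (observable P 0) (1 : HB →L[ℂ] HB) ψ - opTensor (1 : HA →L[ℂ] HA) (obsZ Q) ψ‖ ^ 2
      + ‖opTensor (observable P 1) (1 : HB →L[ℂ] HB) ψ
        - opTensor (1 : HA →L[ℂ] HA) (obsX Q) ψ‖ ^ 2) := by
  obtain ⟨hP, hQ, hψ⟩ := h
  have hone : ⟪ψ, ψ⟫_ℂ = 1 := by rw [inner_self_eq_norm_sq_to_K, hψ]; simp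
  have ha : ∀ x, ⟪opTensor (observable P x) (1 : HB →L[ℂ] HB) ψ,
      opTensor (observable P x) (1 : HB →L[ℂ] HB) ψ⟫_ℂ = 1 := fun x => by
    rw [inner_opTensor_one_left (hP.isSelfAdjoint_observable x), opTensor_observable_sq hP, hone]
  have hb : ∀ y, ⟪opTensor (1 : HA →L[ℂ] HA) (observable Q y) ψ,
      opTensor (1 : HA →L[ℂ] HA) (observable Q y) ψ⟫_ℂ = 1 := fun x => by
    rw [inner_one_opTensor_left (hQ.isSelfAdjoint_observable x), one_opTensor_observable_sq hQ,
        hone]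
  have hab : ∀ x y, ⟪ψ, opTensor (observable P x) (observable Q y) ψ⟫_ℂ
      = ⟪opTensor (observable P x) (1 : HB →L[ℂ] HB) ψ,
        opTensor (1 : HA →L[ℂ] HA) (observable Q y) ψ⟫_ℂ := fun x y => by
    rw [inner_opTensor_one_left (hP.isSelfAdjoint_observable x), ← opTensor_eq_comp]
  have hsym : ∀ v w : HilbertTensor HA HB, (⟪v, w⟫_ℂ).re = (⟪w, v⟫_ℂ).re := fun v w => by
    rw [← inner_conj_symm, Complex.conj_re]
  have h2 := sq_sqrt_two
  -- The marginal terms cancel between the two events of each setting pair, leaving `2 + (⟨A₀B₀⟩ +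
  -- ⟨A₀B₁⟩ + ⟨A₁B₀⟩ - ⟨A₁B₁⟩)/2`. In the squares, `‖Z_Bψ‖² + ‖X_Bψ‖² = 2`.
  simp only [witness, prob, eventVec_eq hP hQ, Fin.sum_univ_eight, event, Matrix.cons_val]
  rw [← inner_self_eq_norm_sq (𝕜 := ℂ), ← inner_self_eq_norm_sq (𝕜 := ℂ), one_opTensor_obsZ,
    one_opTensor_obsX]
  simp only [inner_smul_right, inner_smul_left, inner_add_right, inner_add_left, inner_sub_left,
    inner_sub_right, ha, hb, hab, hone, one_div_sqrt_two, RCLike.re_eq_complex_re]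
  have e00 := hsym (opTensor (observable P 0) (1 : HB →L[ℂ] HB) ψ)
    (opTensor (1 : HA →L[ℂ] HA) (observable Q 0) ψ)
  have e01 := hsym (opTensor (observable P 0) (1 : HB →L[ℂ] HB) ψ)
    (opTensor (1 : HA →L[ℂ] HA) (observable Q 1) ψ)
  have e10 := hsym (opTensor (observable P 1) (1 : HB →L[ℂ] HB) ψ)
    (opTensor (1 : HA →L[ℂ] HA) (observable Q 0) ψ)
  have e11 := hsym (opTensor (observable P 1) (1 : HB →L[ℂ] HB) ψ)
    (opTensor (1 : HA →L[ℂ] HA) (observable Q 1) ψ)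
  simp [map_ofNat]
  rw [← e00, ← e01, ← e10, ← e11]
  clear e00 e01 e10 e11 hsym ha hb hab
  grind

theorem witness_le (h : IsRealization P Q ψ) : witness P Q ψ ≤ 2 + √2 := by
  rw [witness_eq h]
  have := Real.sqrt_nonneg 2
  exact sub_le_self _ (by positivity)

end Witness


/-! ### Self-testing from equality in the bound. -/

section SelfTest

variable {HA : Type u} {HB : Type v} [NormedAddCommGroup HA] [InnerProductSpace ℂ HA]
  [CompleteSpace HA] [NormedAddCommGroup HB] [InnerProductSpace ℂ HB] [CompleteSpace HB]
  {P : Fin 2 → Fin 2 → HA →L[ℂ] HA} {Q : Fin 2 → Fin 2 → HB →L[ℂ] HB} {ψ : HilbertTensor HA HB}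

theorem eq_of_witness_eq (h : IsRealization P Q ψ) (hw : witness P Q ψ = 2 + √2) :
    opTensor (observable P 0) (1 : HB →L[ℂ] HB) ψ = opTensor (1 : HA →L[ℂ] HA) (obsZ Q) ψ ∧
      opTensor (observable P 1) (1 : HB →L[ℂ] HB) ψ = opTensor (1 : HA →L[ℂ] HA) (obsX Q) ψ := by
  rw [witness_eq h, sub_eq_self, mul_eq_zero_iff_left (by positivity),
    add_eq_zero_iff_of_nonneg (by positivity) (by positivity)] at hw
  simpa [sub_eq_zero] using hw

theorem qubitIsometry_refA (hP : IsProjectiveMeasurements P) (x a : Fin 2) (e : Qubit)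
    (k : qubitSpace (observable P 0) (observable P 1)) :
    qubitIsometry (hP.isSelfAdjoint_observable 0) (hP.isSelfAdjoint_observable 1)
        (refA x a e ⊗ₜ[ℂ] k)
      = P x a (qubitIsometry (hP.isSelfAdjoint_observable 0) (hP.isSelfAdjoint_observable 1)
        (e ⊗ₜ[ℂ] k)) := by
  rw [hP.eq_observable]
  fin_cases x
  · simp only [Fin.zero_eta, refA_zero, TensorProduct.add_tmul, ← TensorProduct.smul_tmul', map_add,
      map_smul, qubitIsometry_pauliZ]
    rfl
  · simp only [Fin.mk_one, refA_one, TensorProduct.add_tmul, ← TensorProduct.smul_tmul', map_add,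
      map_smul, qubitIsometry_pauliX]
    rfl

/-- Bob's observables are `(Z_B ± X_B)/√2`, the same combinations as those of the Pauli matrices in
the reference, so intertwining `Z_B` and `X_B` suffices. -/
theorem qubitIsometry_refB (hQ : IsProjectiveMeasurements Q) (y b : Fin 2) (e : Qubit)
    (k : qubitSpace (obsZ Q) (obsX Q)) :
    qubitIsometry hQ.isSelfAdjoint_obsZ hQ.isSelfAdjoint_obsX (refB y b e ⊗ₜ[ℂ] k)
      = Q y b (qubitIsometry hQ.isSelfAdjoint_obsZ hQ.isSelfAdjoint_obsX (e ⊗ₜ[ℂ] k)) := by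
  rw [hQ.eq_observable]
  fin_cases y
  · simp only [Fin.zero_eta, refB_zero, TensorProduct.add_tmul, ← TensorProduct.smul_tmul', map_add,
      map_smul, qubitIsometry_pauliZ, qubitIsometry_pauliX, observable_zero_eq]
    rfl
  · have hsub : pauliZ e - pauliX e = pauliZ e + (-1 : ℂ) • pauliX e := by module
    simp only [Fin.mk_one, refB_one, hsub, TensorProduct.add_tmul, ← TensorProduct.smul_tmul',
      map_add, map_smul, qubitIsometry_pauliZ, qubitIsometry_pauliX, observable_one_eq]
    rw [neg_one_smul, ← sub_eq_add_neg]
    rfl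

theorem isLocallyReference_of_witness_eq (h : IsRealization P Q ψ)
    (hw : witness P Q ψ = 2 + √2) : IsLocallyReference P Q ψ := by
  obtain ⟨hZ, hX⟩ := eq_of_witness_eq h hw
  obtain ⟨hP, hQ, hψ⟩ := h
  have hZX : opTensor (observable P 0) (1 : HB →L[ℂ] HB)
      (opTensor (observable P 1) (1 : HB →L[ℂ] HB) ψ)
      = -opTensor (observable P 1) (1 : HB →L[ℂ] HB)
        (opTensor (observable P 0) (1 : HB →L[ℂ] HB) ψ) := by
    have hanti : opTensor (1 : HA →L[ℂ] HA) (obsX Q) (opTensor (1 : HA →L[ℂ] HA) (obsZ Q) ψ)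
        = -opTensor (1 : HA →L[ℂ] HA) (obsZ Q) (opTensor (1 : HA →L[ℂ] HA) (obsX Q) ψ) := by
      rw [opTensor_opTensor, opTensor_opTensor]
      change opTensor _ (obsX Q * obsZ Q) ψ = -opTensor _ (obsZ Q * obsX Q) ψ
      rw [hQ.obsX_mul_obsZ, ← neg_one_smul ℂ, opTensor_smul_right, _root_.smul_apply, neg_one_smul]
    -- `A₀A₁ψ = X_B Z_B ψ = -Z_B X_B ψ = -A₁A₀ψ`: passing to Bob's side reverses the order of the
    -- factors.
    rw [hX, opTensor_comm, hZ, hanti, ← hX, ← opTensor_comm]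
  obtain ⟨κ, hκ, hκψ⟩ := exists_localImage_refState_eq (hP.isSelfAdjoint_observable 0)
    (hP.isSelfAdjoint_observable 1) hQ.isSelfAdjoint_obsZ hQ.isSelfAdjoint_obsX hψ hZ hX
    (opTensor_observable_sq hP 0 ψ) (opTensor_observable_sq hP 1 ψ) hZX
  have hevent : ∀ x y a b : Fin 2, localImage
      (qubitIsometry (hP.isSelfAdjoint_observable 0) (hP.isSelfAdjoint_observable 1))
      (qubitIsometry hQ.isSelfAdjoint_obsZ hQ.isSelfAdjoint_obsX) κ
      (TensorProduct.mapL (refA x a) (refB y b) refState) = opTensor (P x a) (Q y b) ψ := by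
    intro x y a b
    rw [localImage_mapL κ (qubitIsometry_refA hP x a) (qubitIsometry_refB hQ y b), hκψ]
  refine ⟨qubitSpace (observable P 0) (observable P 1), inferInstance, inferInstance, inferInstance,
    qubitSpace (obsZ Q) (obsX Q), inferInstance, inferInstance, inferInstance,
    qubitIsometry _ _, qubitIsometry _ _, κ, hκ, hκψ, hevent, fun i => ?_⟩
  have hi := hevent (event i).x (event i).y (event i).a (event i).b
  rw [mapL_ref_refState, map_smul] at hi
  rw [eventVec, ← hi, smul_smul, ← Complex.ofReal_mul,
    inv_mul_cancel₀ (Real.sqrt_pos.2 chi_pos).ne', Complex.ofReal_one, one_smul]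

end SelfTest

end CHSH

end

theorem mainTheorem6 :
    -- the exclusivity graph of the eight events of the witness is `Ci₈(1,4)`
    (∀ i j : Fin 8, CHSH.ci8.Adj i j ↔ (CHSH.event i).Exclusive (CHSH.event j)) ∧
    -- the theta SDP has value `2 + √2`, with the unique primal optimum `P`
    IsGreatest (CHSH.thetaValues CHSH.ci8 (fun _ => 1)) (2 + √2) ∧
    (∀ X : Matrix (Fin 9) (Fin 9) ℝ,
      CHSH.IsThetaOptimal CHSH.ci8 (fun _ => 1) X ↔ X = CHSH.matP) ∧
    -- `Z` is a nondegenerate dual optimum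
    CHSH.IsDualOptimal CHSH.ci8 (fun _ => 1) (2 + √2) CHSH.matZ ∧
    CHSH.DualNondegenerate CHSH.ci8 CHSH.matZ ∧
    -- the reference realization attains `2 + √2`; `P` is the Gram matrix of `ψ` and the `Π_i ψ`
    CHSH.IsRealization CHSH.refA CHSH.refB (CHSH.refState : CHSH.HilbertTensor _ _) ∧
    CHSH.witness CHSH.refA CHSH.refB (CHSH.refState : CHSH.HilbertTensor _ _) = 2 + √2 ∧
    Matrix.gram ℂ (Fin.cons (CHSH.refState : CHSH.HilbertTensor CHSH.Qubit CHSH.Qubit)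
      (fun i : Fin 8 => CHSH.eventVec CHSH.refA CHSH.refB
        (CHSH.refState : CHSH.HilbertTensor _ _) (CHSH.event i)) :
        Fin 9 → CHSH.HilbertTensor CHSH.Qubit CHSH.Qubit)
      = CHSH.matP.map ((↑) : ℝ → ℂ) ∧
    -- `2 + √2` is the maximal quantum value, and attaining it self-tests the reference realization
    ∀ (HA : Type u) (HB : Type v)
      [NormedAddCommGroup HA] [InnerProductSpace ℂ HA] [CompleteSpace HA]
      [NormedAddCommGroup HB] [InnerProductSpace ℂ HB] [CompleteSpace HB]
      (P : Fin 2 → Fin 2 → HA →L[ℂ] HA) (Q : Fin 2 → Fin 2 → HB →L[ℂ] HB)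
      (ψ : CHSH.HilbertTensor HA HB),
      CHSH.IsRealization P Q ψ →
        CHSH.witness P Q ψ ≤ 2 + √2 ∧
        (CHSH.witness P Q ψ = 2 + √2 → CHSH.IsLocallyReference P Q ψ) := by
  exact ⟨CHSH.ci8_adj_iff_exclusive, CHSH.isGreatest_thetaValues, CHSH.isThetaOptimal_iff,
    CHSH.isDualOptimal_matZ, CHSH.dualNondegenerate_matZ, CHSH.isRealization_ref, CHSH.witness_ref,
    CHSH.gram_ref, fun _ _ _ _ _ _ _ _ _ _ _ h =>
      ⟨CHSH.witness_le h, CHSH.isLocallyReference_of_witness_eq h⟩⟩
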